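/- An instance with two agents consists of $m$ indivisible items, $\ell$ dimensions, and nonnegative integers $v_{ijk}$, the value of item $j\in\{1,\dots,m\}$ to agent $i\in\{1,2\}$ in dimension $k\in\{1,\dots,\ell\}$; for a set $S$ of items put $v_i(S)_k=\sum_{j\in S}v_{ijk}$. An allocation is a partition $(A_1,A_2)$ of the set of items (a bundle may be empty). For an integer $c\ge 0$ it is strong simultaneously envy-free up to $c$ goods (strong sEF$c$) if for every pair of distinct agents $i,i'$ there is a set $X\subseteq A_{i'}$ with $|X|\le c$ such that $v_i(A_i)_k\ge v_i(A_{i'}\setminus X)_k$ for all dimensions $k$ simultaneously. Theorem. For every instance with two agents and $\ell$ dimensions and every integer $c\ge\max(0,2\ell-1)$, a strong sEF$c$ allocation exists. Moreover, such an allocation can be computed in polynomial time: there is an algorithm that, given any instance with two agents (values in binary), outputs an allocation that is strong sEF$c$ for every integer $c\ge \max(0,2\ell-1)$, with running time (bit cost on a random access machine) at most a fixed polynomial in $m+\ell+\sum_{i,j,k}\bigl(1+\operatorname{bits}(v_{ijk})\bigr)$, where $\operatorname{bits}(v)$ is the number of binary digits of $v$. -/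

import Mathlib

namespace MDFA

/-! ### Multi-dimensional fair allocation -/

/-- An instance with `n` agents: `goods` items, `dims` dimensions, and for each agent, item and
dimension a nonnegative integer value. -/
structure Instance (n : ℕ) where
  goods : ℕ
  dims : ℕ
  value : Fin n → Fin goods → Fin dims → ℕ

/-- An allocation: a partition of the items into one (possibly empty) bundle per agent. -/
structure Allocation {n : ℕ} (I : Instance n) where
  bundle : Fin n → Finset (Fin I.goods)
  disjoint : ∀ i i', i ≠ i' → Disjoint (bundle i) (bundle i')
  cover : ∀ g, ∃ i, g ∈ bundle i

/-- The `k`-th dimensional value of a set of items for agent `i`. -/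
def Instance.setValue {n : ℕ} (I : Instance n) (i : Fin n) (S : Finset (Fin I.goods))
    (k : Fin I.dims) : ℕ :=
  ∑ g ∈ S, I.value i g k

/-- Strong simultaneous envy-freeness up to `c` goods. -/
def Allocation.StrongSEF {n : ℕ} {I : Instance n} (A : Allocation I) (c : ℕ) : Prop :=
  ∀ i i' : Fin n, i ≠ i' → ∃ X : Finset (Fin I.goods), X ⊆ A.bundle i' ∧ X.card ≤ c ∧
    ∀ k : Fin I.dims, I.setValue i (A.bundle i' \ X) k ≤ I.setValue i (A.bundle i) k

/-! ### A random access machine with bit costs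

Programs are finite `while` programs over integer arrays with computed (indirect) addresses. Every
operation is charged for the bit lengths of its operands, of the addresses it uses and of the
contents it moves; multiplication and division are charged the product of the bit lengths. -/

/-- The number of bits of an integer, including one for the sign. -/
def bitLen (z : ℤ) : ℕ := z.natAbs.size + 1

/-- The memory: array number, row, column. -/
abbrev Mem : Type := ℕ → ℕ → ℕ → ℤ

/-- Integer expressions; `read a i j` is the content of the cell in row `i` and column `j` of
array number `a`. -/
inductive Expr : Type
  | const (z : ℤ) : Expr
  | read (a : ℕ) (i j : Expr) : Expr
  | add (e f : Expr) : Expr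
  | sub (e f : Expr) : Expr
  | mul (e f : Expr) : Expr
  | div (e f : Expr) : Expr

/-- The value of an expression. Negative row and column numbers are replaced by `0`, and
division is integer division, with value `0` if the divisor is `0`. -/
def Expr.eval (μ : Mem) : Expr → ℤ
  | const z => z
  | read a i j => μ a (i.eval μ).toNat (j.eval μ).toNat
  | add e f => e.eval μ + f.eval μ
  | sub e f => e.eval μ - f.eval μ
  | mul e f => e.eval μ * f.eval μ
  | div e f => e.eval μ / f.eval μ

/-- The bit cost of evaluating an expression. -/
def Expr.cost (μ : Mem) : Expr → ℕ
  | const z => bitLen z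
  | read a i j => i.cost μ + j.cost μ + bitLen (i.eval μ) + bitLen (j.eval μ)
      + bitLen (μ a (i.eval μ).toNat (j.eval μ).toNat)
  | add e f => e.cost μ + f.cost μ + bitLen (e.eval μ) + bitLen (f.eval μ)
  | sub e f => e.cost μ + f.cost μ + bitLen (e.eval μ) + bitLen (f.eval μ)
  | mul e f => e.cost μ + f.cost μ + bitLen (e.eval μ) * bitLen (f.eval μ)
  | div e f => e.cost μ + f.cost μ + bitLen (e.eval μ) * bitLen (f.eval μ)

/-- Programs. `write a i j e` stores the value of `e` in row `i`, column `j` of array `a`;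
`cond e p q` runs `p` if `e` is positive and `q` otherwise; `loop e p` runs `p` as long as `e` is
positive. -/
inductive Program : Type
  | nop : Program
  | write (a : ℕ) (i j e : Expr) : Program
  | seq (p q : Program) : Program
  | cond (e : Expr) (p q : Program) : Program
  | loop (e : Expr) (p : Program) : Program

/-- The memory after storing `z` in row `i`, column `j` of array `a`. -/
def Mem.set (μ : Mem) (a i j : ℕ) (z : ℤ) : Mem :=
  fun a' i' j' => if a' = a ∧ i' = i ∧ j' = j then z else μ a' i' j'

/-- `Exec p μ ν t`: started in memory `μ`, the program `p` halts in memory `ν` at total cost `t`. -/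
inductive Exec : Program → Mem → Mem → ℕ → Prop
  | nop (μ : Mem) : Exec .nop μ μ 1
  | write (μ : Mem) (a : ℕ) (i j e : Expr) :
      Exec (.write a i j e) μ (μ.set a (i.eval μ).toNat (j.eval μ).toNat (e.eval μ))
        (i.cost μ + j.cost μ + e.cost μ
          + bitLen (i.eval μ) + bitLen (j.eval μ) + bitLen (e.eval μ))
  | seq {p q : Program} {μ ν ρ : Mem} {s t : ℕ} :
      Exec p μ ν s → Exec q ν ρ t → Exec (.seq p q) μ ρ (s + t)
  | condTrue {e : Expr} {p q : Program} {μ ν : Mem} {t : ℕ} :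
      0 < e.eval μ → Exec p μ ν t →
        Exec (.cond e p q) μ ν (e.cost μ + bitLen (e.eval μ) + t)
  | condFalse {e : Expr} {p q : Program} {μ ν : Mem} {t : ℕ} :
      ¬ 0 < e.eval μ → Exec q μ ν t →
        Exec (.cond e p q) μ ν (e.cost μ + bitLen (e.eval μ) + t)
  | loopTrue {e : Expr} {p : Program} {μ ν ρ : Mem} {s t : ℕ} :
      0 < e.eval μ → Exec p μ ν s → Exec (.loop e p) ν ρ t →
        Exec (.loop e p) μ ρ (e.cost μ + bitLen (e.eval μ) + s + t)
  | loopFalse {e : Expr} {p : Program} {μ : Mem} :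
      ¬ 0 < e.eval μ → Exec (.loop e p) μ μ (e.cost μ + bitLen (e.eval μ))

/-- The machine is deterministic: final memory and running time are functions of the input. -/
theorem Exec.deterministic {p : Program} {μ ν ν' : Mem} {t t' : ℕ}
    (h : Exec p μ ν t) (h' : Exec p μ ν' t') : ν = ν' ∧ t = t' := by
  induction h generalizing ν' t' with
  | nop μ => cases h'; exact ⟨rfl, rfl⟩
  | write μ a i j e => cases h'; exact ⟨rfl, rfl⟩
  | seq _ _ ih₁ ih₂ =>
    cases h' with
    | seq k₁ k₂ =>
      obtain ⟨rfl, rfl⟩ := ih₁ k₁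
      obtain ⟨rfl, rfl⟩ := ih₂ k₂
      exact ⟨rfl, rfl⟩
  | condTrue hc _ ih =>
    cases h' with
    | condTrue _ k => obtain ⟨rfl, rfl⟩ := ih k; exact ⟨rfl, rfl⟩
    | condFalse hn _ => exact absurd hc hn
  | condFalse hc _ ih =>
    cases h' with
    | condTrue hn _ => exact absurd hn hc
    | condFalse _ k => obtain ⟨rfl, rfl⟩ := ih k; exact ⟨rfl, rfl⟩
  | loopTrue hc _ _ ih₁ ih₂ =>
    cases h' with
    | loopTrue _ k₁ k₂ =>
      obtain ⟨rfl, rfl⟩ := ih₁ k₁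
      obtain ⟨rfl, rfl⟩ := ih₂ k₂
      exact ⟨rfl, rfl⟩
    | loopFalse hn => exact absurd hc hn
  | loopFalse hc =>
    cases h' with
    | loopTrue hn _ _ => exact absurd hn hc
    | loopFalse _ => exact ⟨rfl, rfl⟩

/-- A search problem, with instances of type `ι`, is solved in polynomial time: one program halts
on every instance `x`, in a memory that is a solution for `x`, at a cost that is at most a fixed
polynomial in the size of `x`. -/
def SolvableInPolyTime {ι : Type} (size : ι → ℕ) (input : ι → Mem) (IsSolution : ι → Mem → Prop) :
    Prop :=
  ∃ (p : Program) (P : Polynomial ℕ), ∀ x : ι, ∃ (ν : Mem) (t : ℕ),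
    Exec p (input x) ν t ∧ t ≤ P.eval (size x) ∧ IsSolution x ν

/-! ### Two-agent instances as inputs -/

/-- The size of an instance: the numbers of agents, items and dimensions plus the total length of
all values in binary. -/
def Instance.size {n : ℕ} (I : Instance n) : ℕ :=
  n + I.goods + I.dims + ∑ i, ∑ g, ∑ k, bitLen (I.value i g k)

/-- The initial memory: the numbers of items and of dimensions in array `0`, the values of the
first agent in array `1` (row = item, column = dimension), those of the second agent in array `2`,
and `0` in all other cells. -/
def Instance.toMem (I : Instance 2) : Mem
  | 0, 0, 0 => I.goods
  | 0, 0, 1 => I.dims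
  | 1, g, k => if h : g < I.goods ∧ k < I.dims then I.value 0 ⟨g, h.1⟩ ⟨k, h.2⟩ else 0
  | 2, g, k => if h : g < I.goods ∧ k < I.dims then I.value 1 ⟨g, h.1⟩ ⟨k, h.2⟩ else 0
  | _, _, _ => 0

/-- The allocation `A` is written in array `3`: the first cell of row `g` holds the number
(`0` or `1`) of the agent that receives item `g`. -/
def Allocation.IsWrittenIn {I : Instance 2} (A : Allocation I) (ν : Mem) : Prop :=
  ∀ (g : Fin I.goods) (i : Fin 2), g ∈ A.bundle i ↔ ν 3 g 0 = (i : ℕ)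

end MDFA

/-! Let the first agent own a fraction of every item, initially one half. Then both shares are worth
the same to both agents in every dimension. This equality is kept in all dimensions for the second
agent and in all but dimension `0` for the first, where only "at least as good" is kept; that makes
`2 * L - 1` linear equations. While more items than that are split, some nonzero vector supported on
the split items satisfies the homogeneous equations. With the sign that does not hurt the first
agent in dimension `0`, moving along it until an item becomes whole keeps all conditions. Eventually
at most `2 * L - 1` items are split (`IsHalving.numWhole_shift`, `IsVertex.card_split_le`).

Each item then goes to the agent with the larger share. An agent compares the own bundle with the
other one minus its split items: a split item won counts fully, a split item lost counts `0`
although the own share was at most one half, and a whole item counts as before. So the difference is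
at least the fractional balance, which is nonnegative (`setValue_sdiff_split_le`).

For the algorithm, the fractions are `X i / D` with integers and a common denominator. Directions
are columns of an integer matrix whose range is the kernel of a Gram matrix, computed by a
Faddeev–LeVerrier recursion without divisions (`faddeev_spec`). Its entries are at most `q ^ m`
(`Fits.abs_faddeev_le`), so each of the `m` rounds multiplies `D` by at most `q ^ m`, and all
numbers have polynomially many digits (`Instance.fits`). Every loop runs at most `N` times, so once
all cells have at most `β` digits the cost is at most a polynomial in `N` times `(β + 1) ^ 2`. The
predicate `Runs` therefore carries correctness, digit bound and running time together, and
`Runs.wholeStep` verifies one round. -/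

namespace MDFA

/-! ### Running time of programs on bounded memories -/

/-- All cells have at most `β` binary digits. -/
def Bounded (β : ℕ) (μ : Mem) : Prop := ∀ a i j, |μ a i j| < 2 ^ β

theorem bitLen_le_iff {z : ℤ} {β : ℕ} : bitLen z ≤ β + 1 ↔ |z| < 2 ^ β := by
  rw [bitLen, Nat.add_le_add_iff_right, Nat.size_le, Int.abs_eq_natAbs]
  exact_mod_cast Iff.rfl

theorem natAbs_lt_bitLen (z : ℤ) : z.natAbs < 2 ^ (bitLen z - 1) := by
  simpa [bitLen] using Nat.lt_size_self z.natAbs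

theorem one_le_bitLen (z : ℤ) : 1 ≤ bitLen z := by simp [bitLen]

theorem bitLen_le_of_natAbs_lt {z : ℤ} {n : ℕ} (h : z.natAbs < 2 ^ n) : bitLen z ≤ n + 1 := by
  simpa [bitLen] using Nat.size_le.2 h

/-- One of the two sign bits on the right absorbs the carry of an addition. -/
theorem bitLen_le_add_of_natAbs_le {x y z : ℤ} (h : z.natAbs ≤ x.natAbs + y.natAbs) :
    bitLen z ≤ bitLen x + bitLen y := by
  have hx := natAbs_lt_bitLen x
  have hy := natAbs_lt_bitLen y
  have hx1 := one_le_bitLen x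
  have hy1 := one_le_bitLen y
  have hx2 : 2 ^ (bitLen x - 1) ≤ 2 ^ (bitLen x + bitLen y - 2) :=
    Nat.pow_le_pow_right (by norm_num) (by omega)
  have hy2 : 2 ^ (bitLen y - 1) ≤ 2 ^ (bitLen x + bitLen y - 2) :=
    Nat.pow_le_pow_right (by norm_num) (by omega)
  have h3 : 2 ^ (bitLen x + bitLen y - 2 + 1) = 2 * 2 ^ (bitLen x + bitLen y - 2) := by
    rw [pow_succ, mul_comm]
  have := bitLen_le_of_natAbs_lt (z := z) (n := bitLen x + bitLen y - 2 + 1) (by omega)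
  omega

theorem bitLen_mul_le (x y : ℤ) : bitLen (x * y) ≤ bitLen x + bitLen y := by
  have hx1 := one_le_bitLen x
  have hy1 := one_le_bitLen y
  have h : (x * y).natAbs < 2 ^ (bitLen x - 1 + (bitLen y - 1)) := by
    rw [Int.natAbs_mul, pow_add]
    exact Nat.mul_lt_mul'' (natAbs_lt_bitLen x) (natAbs_lt_bitLen y)
  have := bitLen_le_of_natAbs_lt h
  omega

/-- A bound on the bit length of the value, and on the square root of the cost, of an expression
on memories whose cells have unit bit length. -/
def Expr.weight : Expr → ℕ
  | const z => bitLen z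
  | read _ i j => i.weight + j.weight + 1
  | add e f => e.weight + f.weight
  | sub e f => e.weight + f.weight
  | mul e f => e.weight + f.weight
  | div e f => e.weight + f.weight

theorem Expr.one_le_weight (e : Expr) : 1 ≤ e.weight := by
  induction e with
  | const z => exact one_le_bitLen z
  | _ => simp only [Expr.weight]; omega

theorem Expr.bitLen_eval_le {β : ℕ} {μ : Mem} (hμ : Bounded β μ) (e : Expr) :
    bitLen (e.eval μ) ≤ e.weight * (β + 1) := by
  induction e with
  | const z => exact Nat.le_mul_of_pos_right _ (by omega)
  | read a i j _ _ =>
    refine (bitLen_le_iff.2 (hμ _ _ _)).trans (Nat.le_mul_of_pos_left _ ?_)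
    simp [weight]
  | add e f ihe ihf =>
    rw [weight, add_mul]
    exact (bitLen_le_add_of_natAbs_le (Int.natAbs_add_le _ _)).trans (add_le_add ihe ihf)
  | sub e f ihe ihf =>
    rw [weight, add_mul]
    exact (bitLen_le_add_of_natAbs_le (Int.natAbs_sub_le _ _)).trans (add_le_add ihe ihf)
  | mul e f ihe ihf =>
    rw [weight, add_mul]
    exact (bitLen_mul_le _ _).trans (add_le_add ihe ihf)
  | div e f ihe ihf =>
    rw [weight, add_mul]
    exact (bitLen_le_add_of_natAbs_le ((Int.natAbs_ediv_le_natAbs _ _).trans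
      (Nat.le_add_right _ _))).trans (add_le_add ihe ihf)

/-- Squares of weights are used because `(s + t) ^ 2 = s ^ 2 + t ^ 2 + 2 * s * t`: the first two
terms pay for the subexpressions, and the cross term pays for the new operation, whether it is
charged the sum or the product of the bit lengths. -/
theorem Expr.cost_le {β : ℕ} {μ : Mem} (hμ : Bounded β μ) (e : Expr) :
    e.cost μ ≤ e.weight ^ 2 * (β + 1) ^ 2 := by
  have key : ∀ {a b s t x y c : ℕ}, a ≤ s ^ 2 * (β + 1) ^ 2 → b ≤ t ^ 2 * (β + 1) ^ 2 →
      x ≤ s * (β + 1) → y ≤ t * (β + 1) → 1 ≤ s → 1 ≤ t → c ≤ x + y ∨ c ≤ x * y →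
      a + b + c ≤ (s + t) ^ 2 * (β + 1) ^ 2 := by
    intro a b s t x y c ha hb hx hy hs ht hc
    have h1 : c ≤ 2 * ((s * (β + 1)) * (t * (β + 1))) := by
      have hs' : 1 ≤ s * (β + 1) := Nat.mul_pos hs (by omega)
      have ht' : 1 ≤ t * (β + 1) := Nat.mul_pos ht (by omega)
      rcases hc with hc | hc
      · nlinarith
      · nlinarith [Nat.mul_le_mul hx hy]
    calc a + b + c ≤ s ^ 2 * (β + 1) ^ 2 + t ^ 2 * (β + 1) ^ 2
          + 2 * ((s * (β + 1)) * (t * (β + 1))) := by omega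
      _ = _ := by ring
  induction e with
  | const z =>
    have := one_le_bitLen z
    simp only [cost, weight]
    nlinarith [Nat.mul_le_mul this this, Nat.one_le_pow 2 (β + 1) (by omega),
      Nat.mul_le_mul_left (bitLen z ^ 2) (Nat.one_le_pow 2 (β + 1) (by omega))]
  | read a i j ihi ihj =>
    have h := key ihi ihj (bitLen_eval_le hμ i) (bitLen_eval_le hμ j) i.one_le_weight
      j.one_le_weight (Or.inl le_rfl)
    have h2 : bitLen (μ a (i.eval μ).toNat (j.eval μ).toNat) ≤ (β + 1) ^ 2 :=
      (bitLen_le_iff.2 (hμ _ _ _)).trans (by nlinarith)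
    simp only [cost, weight]
    calc _ ≤ (i.weight + j.weight) ^ 2 * (β + 1) ^ 2 + (β + 1) ^ 2 := by omega
      _ ≤ _ := by
        rw [← Nat.succ_mul]
        exact Nat.mul_le_mul_right _ (by nlinarith [Nat.zero_le (i.weight + j.weight)])
  | add e f ihe ihf =>
    rw [cost, add_assoc]
    exact key ihe ihf (bitLen_eval_le hμ e) (bitLen_eval_le hμ f) e.one_le_weight
      f.one_le_weight (Or.inl le_rfl)
  | sub e f ihe ihf =>
    rw [cost, add_assoc]
    exact key ihe ihf (bitLen_eval_le hμ e) (bitLen_eval_le hμ f) e.one_le_weight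
      f.one_le_weight (Or.inl le_rfl)
  | mul e f ihe ihf =>
    exact key ihe ihf (bitLen_eval_le hμ e) (bitLen_eval_le hμ f) e.one_le_weight
      f.one_le_weight (Or.inr le_rfl)
  | div e f ihe ihf =>
    exact key ihe ihf (bitLen_eval_le hμ e) (bitLen_eval_le hμ f) e.one_le_weight
      f.one_le_weight (Or.inr le_rfl)

theorem Expr.guard_cost_le {β : ℕ} {μ : Mem} (hμ : Bounded β μ) (e : Expr) :
    e.cost μ + bitLen (e.eval μ) ≤ 2 * e.weight ^ 2 * (β + 1) ^ 2 := by
  have h := e.cost_le hμ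
  have h2 := e.bitLen_eval_le hμ
  have h3 : e.weight * (β + 1) ≤ e.weight ^ 2 * (β + 1) ^ 2 := by
    rw [← mul_pow]
    exact Nat.le_self_pow (by norm_num) _
  rw [mul_assoc]
  omega

/-- The arrays a program may write to. -/
def Program.writes : Program → List ℕ
  | nop => []
  | write a _ _ _ => [a]
  | seq p q => p.writes ++ q.writes
  | cond _ p q => p.writes ++ q.writes
  | loop _ p => p.writes

theorem Mem.set_of_ne {μ : Mem} {a b : ℕ} (h : b ≠ a) (i j : ℕ) (z : ℤ) :
    μ.set a i j z b = μ b := by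
  funext i' j'
  simp [Mem.set, h]

/-- The frame rule: facts about arrays outside `writes` survive a program, and membership in that
list is settled by `decide`. -/
theorem Exec.eq_of_notMem_writes {p : Program} {μ ν : Mem} {t : ℕ} (h : Exec p μ ν t) {a : ℕ}
    (ha : a ∉ p.writes) : ν a = μ a := by
  induction h with
  | nop μ => rfl
  | write μ b i j e => exact Mem.set_of_ne (by simpa [Program.writes] using ha) _ _ _
  | seq _ _ ih₁ ih₂ =>
    simp only [Program.writes, List.mem_append, not_or] at ha
    rw [ih₂ ha.2, ih₁ ha.1]
  | condTrue _ _ ih =>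
    simp only [Program.writes, List.mem_append, not_or] at ha
    exact ih ha.1
  | condFalse _ _ ih =>
    simp only [Program.writes, List.mem_append, not_or] at ha
    exact ih ha.2
  | loopTrue _ _ _ ih₁ ih₂ => rw [ih₂ ha, ih₁ ha]
  | loopFalse _ => rfl

open Polynomial in
/-- The number of operations of a program, up to constants, as a polynomial in a bound for the
number of iterations of every loop. -/
noncomputable def Program.timePoly : Program → Polynomial ℕ
  | nop => 1
  | write _ i j e => C (2 * (i.weight ^ 2 + j.weight ^ 2 + e.weight ^ 2))
  | seq p q => p.timePoly + q.timePoly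
  | cond e p q => C (2 * e.weight ^ 2) + (p.timePoly + q.timePoly)
  | loop e p => (X + 1) * (C (2 * e.weight ^ 2) + p.timePoly)

/-- Started in `μ`, the program `p` halts in a memory with property `Q` whose cells have at most
`β` binary digits, within the time predicted by `Program.timePoly` if loops run at most `N`
times. -/
def Runs (N β : ℕ) (p : Program) (μ : Mem) (Q : Mem → Prop) : Prop :=
  ∃ ν t, Exec p μ ν t ∧ t ≤ p.timePoly.eval N * (β + 1) ^ 2 ∧ Bounded β ν ∧ Q ν

namespace Runs

variable {N β : ℕ} {p q : Program} {μ : Mem} {Q R : Mem → Prop}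

theorem mono (h : Runs N β p μ R)
    (hR : ∀ ν, Bounded β ν → (∀ a, a ∉ p.writes → ν a = μ a) → R ν → Q ν) : Runs N β p μ Q := by
  obtain ⟨ν, t, h1, h2, h3, h4⟩ := h
  exact ⟨ν, t, h1, h2, h3, hR ν h3 (fun a ha => h1.eq_of_notMem_writes ha) h4⟩

theorem nop (hμ : Bounded β μ) (hQ : Q μ) : Runs N β .nop μ Q :=
  ⟨μ, 1, .nop μ, by simp [Program.timePoly, Nat.one_le_pow], hμ, hQ⟩

theorem write {a : ℕ} {i j e : Expr} (hμ : Bounded β μ) (he : |e.eval μ| < 2 ^ β)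
    (hQ : Q (μ.set a (i.eval μ).toNat (j.eval μ).toNat (e.eval μ))) :
    Runs N β (.write a i j e) μ Q := by
  refine ⟨_, _, .write μ a i j e, ?_, ?_, hQ⟩
  · have h1 := i.guard_cost_le hμ
    have h2 := j.guard_cost_le hμ
    have h3 := e.guard_cost_le hμ
    simp only [Program.timePoly, Polynomial.eval_C]
    calc _ ≤ 2 * i.weight ^ 2 * (β + 1) ^ 2 + 2 * j.weight ^ 2 * (β + 1) ^ 2
          + 2 * e.weight ^ 2 * (β + 1) ^ 2 := by omega
      _ = _ := by ring
  · intro a' i' j'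
    unfold Mem.set
    split_ifs
    · exact he
    · exact hμ _ _ _

theorem seq (hp : Runs N β p μ R)
    (hq : ∀ ν, Bounded β ν → (∀ a, a ∉ p.writes → ν a = μ a) → R ν → Runs N β q ν Q) :
    Runs N β (.seq p q) μ Q := by
  obtain ⟨ν, s, h1, h2, h3, h4⟩ := hp
  obtain ⟨ρ, t, k1, k2, k3, k4⟩ := hq ν h3 (fun a ha => h1.eq_of_notMem_writes ha) h4
  refine ⟨ρ, s + t, .seq h1 k1, ?_, k3, k4⟩
  simp only [Program.timePoly, Polynomial.eval_add, add_mul]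
  exact add_le_add h2 k2

theorem cond {e : Expr} (hμ : Bounded β μ) (hp : 0 < e.eval μ → Runs N β p μ Q)
    (hq : e.eval μ ≤ 0 → Runs N β q μ Q) : Runs N β (.cond e p q) μ Q := by
  have hg := e.guard_cost_le hμ
  by_cases h : 0 < e.eval μ
  · obtain ⟨ν, t, h1, h2, h3, h4⟩ := hp h
    refine ⟨ν, _, .condTrue h h1, ?_, h3, h4⟩
    simp only [Program.timePoly, Polynomial.eval_add, Polynomial.eval_C, add_mul]
    omega
  · obtain ⟨ν, t, h1, h2, h3, h4⟩ := hq (not_lt.1 h)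
    refine ⟨ν, _, .condFalse h h1, ?_, h3, h4⟩
    simp only [Program.timePoly, Polynomial.eval_add, Polynomial.eval_C, add_mul]
    omega

end Runs

/-- The expression for a variable, stored in the first cell of an array. -/
abbrev var (x : ℕ) : Expr := .read x (.const 0) (.const 0)

/-- Assignment to a variable. -/
abbrev assign (x : ℕ) (e : Expr) : Program := .write x (.const 0) (.const 0) e

/-- `for x = 0, …, n - 1`, where `n` is the content of the cell in row `0`, column `c` of
array `0`. -/
def forLoop (x : ℕ) (c : ℤ) (p : Program) : Program :=
  .seq (assign x (.const 0))
    (.loop (.sub (.read 0 (.const 0) (.const c)) (var x))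
      (.seq p (assign x (.add (var x) (.const 1)))))

/-- The loop rule. The body may assume that arrays other than `x` and those it writes are as in the
initial memory `μ`; `hset` says that the invariant ignores the counter. -/
theorem Runs.forLoop {N β : ℕ} {p : Program} {μ : Mem} {x K : ℕ} {c : ℤ}
    (Inv : ℕ → Mem → Prop) (hμ : Bounded β μ) (hK : μ 0 0 c.toNat = K) (hN : K ≤ N)
    (hβ : (K : ℤ) < 2 ^ β)
    (hx : x ∉ p.writes) (hx0 : x ≠ 0) (h0 : 0 ∉ p.writes)
    (hset : ∀ k ν z, Inv k ν → Inv k (ν.set x 0 0 z)) (hinit : Inv 0 μ)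
    (hstep : ∀ k < K, ∀ ν, Bounded β ν → ν x 0 0 = k →
      (∀ a, a ≠ x → a ∉ p.writes → ν a = μ a) → Inv k ν → Runs N β p ν (Inv (k + 1))) :
    Runs N β (forLoop x c p) μ (Inv K) := by
  set g : Expr := .sub (.read 0 (.const 0) (.const c)) (var x) with hg
  set inc : Program := assign x (.add (var x) (.const 1)) with hinc
  -- Induction on the number `d` of remaining iterations; the factor `d + 1` counts the final,
  -- failing test of the guard.
  have loop : ∀ d k, k + d = K → ∀ ν, Bounded β ν → ν x 0 0 = k →
      (∀ a, a ≠ x → a ∉ p.writes → ν a = μ a) → Inv k ν →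
      ∃ ρ t, Exec (.loop g (.seq p inc)) ν ρ t ∧
        t ≤ (d + 1) * (2 * g.weight ^ 2 + (p.timePoly.eval N + inc.timePoly.eval N))
          * (β + 1) ^ 2 ∧ Bounded β ρ ∧ Inv K ρ := by
    intro d
    induction d with
    | zero =>
      intro k hk ν hν hνx hfr hI
      have hgv : g.eval ν = K - k := by
        simp [hg, Expr.eval, hνx, hfr 0 hx0.symm h0, hK]
      obtain rfl : k = K := by omega
      refine ⟨ν, _, .loopFalse (by simp [hgv]), ?_, hν, hI⟩
      refine (g.guard_cost_le hν).trans (Nat.mul_le_mul_right _ ?_)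
      omega
    | succ d ih =>
      intro k hk ν hν hνx hfr hI
      have hgv : g.eval ν = K - k := by
        simp [hg, Expr.eval, hνx, hfr 0 hx0.symm h0, hK]
      obtain ⟨ν₁, t₁, e₁, c₁, b₁, I₁⟩ := hstep k (by omega) ν hν hνx hfr hI
      have hν₁x : ν₁ x 0 0 = k := by rw [e₁.eq_of_notMem_writes hx, hνx]
      have hev : (Expr.add (var x) (.const 1)).eval ν₁ = ((k + 1 : ℕ) : ℤ) := by
        simp [Expr.eval, hν₁x]
      obtain ⟨ν₂, t₂, e₂, c₂, b₂, rfl⟩ : Runs N β inc ν₁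
          (fun ν₂ => ν₂ = ν₁.set x 0 0 ((k + 1 : ℕ) : ℤ)) := by
        refine Runs.write b₁ ?_ ?_
        · rw [hev, abs_of_nonneg (by positivity)]
          exact lt_of_le_of_lt (by exact_mod_cast (by omega : k + 1 ≤ K)) hβ
        · rw [hev]; rfl
      obtain ⟨ρ, t, e₃, c₃, b₃, I₃⟩ := ih (k + 1) (by omega) _ b₂ (by simp [Mem.set])
        (fun a hax hap => by
          rw [Mem.set_of_ne hax, e₁.eq_of_notMem_writes hap, hfr a hax hap]) (hset _ _ _ I₁)
      refine ⟨ρ, _, .loopTrue (by rw [hgv]; omega) (.seq e₁ e₂) e₃, ?_, b₃, I₃⟩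
      have hc := g.guard_cost_le hν
      calc _ ≤ 2 * g.weight ^ 2 * (β + 1) ^ 2 + (p.timePoly.eval N * (β + 1) ^ 2
            + inc.timePoly.eval N * (β + 1) ^ 2) + _ :=
            add_le_add (add_le_add hc (add_le_add c₁ c₂)) c₃
        _ = _ := by ring
  refine Runs.seq (R := fun ν => ν = μ.set x 0 0 0) (Runs.write hμ (by simp [Expr.eval]) rfl) ?_
  rintro ν hν - rfl
  obtain ⟨ρ, t, e, ht, b, I⟩ := loop K 0 (by omega) _ hν (by simp [Mem.set])
    (fun a ha _ => Mem.set_of_ne ha _ _ _) (hset _ _ _ hinit)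
  refine ⟨ρ, t, e, ht.trans (Nat.mul_le_mul_right _ ?_), b, I⟩
  simp only [Program.timePoly, Polynomial.eval_mul, Polynomial.eval_add, Polynomial.eval_X,
    Polynomial.eval_one, Polynomial.eval_C]
  refine Nat.mul_le_mul (by omega) (le_of_eq ?_)
  simp [hg, hinc, Program.timePoly]

/-! ### Kernels of Gram matrices without division -/

section ElementarySymmetric

variable {ι : Type*} (l : ι → ℝ)

/-- The elementary symmetric sum of degree `k` of the numbers `l i`, `i ∈ s`. -/
def elemSum (s : Finset ι) (k : ℕ) : ℝ := ∑ t ∈ s.powersetCard k, ∏ i ∈ t, l i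

variable {l}

theorem elemSum_zero (s : Finset ι) : elemSum l s 0 = 1 := by simp [elemSum]

theorem elemSum_nonneg (hl : ∀ i, 0 ≤ l i) (s : Finset ι) (k : ℕ) : 0 ≤ elemSum l s k :=
  Finset.sum_nonneg fun _ _ => Finset.prod_nonneg fun _ _ => hl _

variable [DecidableEq ι]

theorem elemSum_succ_eq_erase {s : Finset ι} {i : ι} (hi : i ∈ s) (k : ℕ) :
    elemSum l s (k + 1) = elemSum l (s.erase i) (k + 1) + l i * elemSum l (s.erase i) k := by
  have hn : i ∉ s.erase i := Finset.notMem_erase i s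
  have hmem : ∀ {j} {t : Finset ι}, t ∈ (s.erase i).powersetCard j → i ∉ t := fun ht h =>
    hn ((Finset.mem_powersetCard.1 ht).1 h)
  conv_lhs => rw [elemSum, ← Finset.insert_erase hi, Finset.powersetCard_succ_insert hn]
  rw [Finset.sum_union, Finset.sum_image, elemSum, elemSum, Finset.mul_sum]
  · congr 1
    exact Finset.sum_congr rfl fun t ht => Finset.prod_insert (hmem ht)
  · intro t ht t' ht' h
    rw [← Finset.erase_insert (hmem ht), ← Finset.erase_insert (hmem ht'), h]
  · rw [Finset.disjoint_left]
    intro t ht ht'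
    obtain ⟨t', -, rfl⟩ := Finset.mem_image.1 ht'
    exact hmem ht (Finset.mem_insert_self _ _)

/-- The left side counts the product over each `(k + 1)`-subset once for each of its elements. -/
theorem sum_mul_elemSum_erase (s : Finset ι) (k : ℕ) :
    ∑ i ∈ s, l i * elemSum l (s.erase i) k = (k + 1) * elemSum l s (k + 1) := by
  have h : ∀ i ∈ s, l i * elemSum l (s.erase i) k
      = ∑ t ∈ s.powersetCard (k + 1), if i ∈ t then ∏ j ∈ t, l j else 0 := by
    intro i hi
    have h1 := elemSum_succ_eq_erase (l := l) hi k
    have h2 : elemSum l (s.erase i) (k + 1)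
        = ∑ t ∈ s.powersetCard (k + 1), if i ∈ t then 0 else ∏ j ∈ t, l j := by
      simp_rw [elemSum, ← ite_not (p := i ∈ _)]
      rw [← Finset.sum_filter]
      refine Finset.sum_congr ?_ fun _ _ => rfl
      ext t
      simp only [Finset.mem_powersetCard, Finset.mem_filter, Finset.subset_erase]
      tauto
    rw [← sub_eq_iff_eq_add'.2 h1, h2, elemSum, ← Finset.sum_sub_distrib]
    exact Finset.sum_congr rfl fun t _ => by split_ifs <;> simp
  rw [Finset.sum_congr rfl h, Finset.sum_comm, elemSum, Finset.mul_sum]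
  refine Finset.sum_congr rfl fun t ht => ?_
  obtain ⟨hts, htk⟩ := Finset.mem_powersetCard.1 ht
  rw [← Finset.sum_filter, Finset.sum_const, Finset.filter_mem_eq_inter,
    Finset.inter_eq_right.2 hts, htk]
  simp

end ElementarySymmetric

section FaddeevLeVerrier

open Matrix

variable {ι : Type*} [Fintype ι] [DecidableEq ι]

/-- The matrices of the Faddeev–LeVerrier algorithm, scaled by factorials so that no division is
needed, up to the first vanishing coefficient of the characteristic polynomial. -/
def faddeev (G : Matrix ι ι ℤ) : ℕ → Matrix ι ι ℤ
  | 0 => 1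
  | k + 1 =>
    if 0 < (G * faddeev G k).trace then
      (G * faddeev G k).trace • (1 : Matrix ι ι ℤ) - (k + 1 : ℤ) • (G * faddeev G k)
    else faddeev G k

/-- In an eigenbasis of `G`, with eigenvalues `l i ≥ 0`, the `k`-th matrix is diagonal with entries
`k! * e_k` of the eigenvalues other than `l i`, until the trace `(k + 1)! * e_(k+1)` vanishes. This
happens when `k` is the rank. Then the entry is `0` where `l i ≠ 0` and a fixed positive number
where `l i = 0`, so the matrix is a positive multiple of the projection onto the kernel. If `G` is
invertible, the recursion ends with the zero matrix. -/
theorem faddeev_spec {ρ : Type*} [Fintype ρ] (A : Matrix ρ ι ℝ) (G : Matrix ι ι ℤ)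
    (hG : G.map (Int.cast : ℤ → ℝ) = Aᵀ * A) :
    G * faddeev G (Fintype.card ι) = 0 ∧
      ((∃ y : ι → ℝ, y ≠ 0 ∧ A *ᵥ y = 0) → 0 < (faddeev G (Fintype.card ι)).trace) := by
  have hpsd : (Aᵀ * A).PosSemidef := by
    simpa [conjTranspose_eq_transpose_of_trivial] using posSemidef_conjTranspose_mul_self A
  set l := hpsd.isHermitian.eigenvalues with hl_def
  have hl : ∀ i, 0 ≤ l i := hpsd.eigenvalues_nonneg
  set c : Matrix ι ι ℤ →+* Matrix ι ι ℝ := (Int.castRingHom ℝ).mapMatrix with hc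
  have hcinj : Function.Injective c := Matrix.map_injective Int.cast_injective
  have hctr : ∀ M, (c M).trace = (M.trace : ℝ) := fun M =>
    (AddMonoidHom.map_trace (Int.castRingHom ℝ) M).symm
  -- `φ` is conjugation by the eigenvector matrix; as a trace-preserving algebra homomorphism it
  -- moves the whole recursion to diagonal matrices.
  obtain ⟨φ, hφtr, hφ⟩ : ∃ φ : Matrix ι ι ℝ →ₐ[ℝ] Matrix ι ι ℝ,
      (∀ M, (φ M).trace = M.trace) ∧ c G = φ (diagonal l) := by
    refine ⟨(Unitary.conjStarAlgAut ℝ _ hpsd.isHermitian.eigenvectorUnitary : _ →ₐ[ℝ] _),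
      fun M => ?_, ?_⟩
    · simp [Unitary.conjStarAlgAut_apply, Matrix.trace_mul_comm, ← mul_assoc]
    · exact hG.trans hpsd.isHermitian.spectral_theorem
  have hdet : (∃ y : ι → ℝ, y ≠ 0 ∧ A *ᵥ y = 0) → ∃ i, l i = 0 := by
    rintro ⟨y, hy, hAy⟩
    have : (Aᵀ * A).det = 0 :=
      exists_mulVec_eq_zero_iff.1 ⟨y, hy, by rw [← mulVec_mulVec, hAy, mulVec_zero]⟩
    rw [hpsd.isHermitian.det_eq_prod_eigenvalues, Finset.prod_eq_zero_iff] at this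
    obtain ⟨i, -, hi⟩ := this
    exact ⟨i, hi⟩
  -- Left: the recursion is still running. Right: it has stopped, and both conclusions hold from
  -- then on.
  have main : ∀ k, (c (faddeev G k)
        = φ (diagonal fun i => (k.factorial : ℝ) * elemSum l (Finset.univ.erase i) k) ∧
        0 < elemSum l Finset.univ k) ∨
      (G * faddeev G k = 0 ∧
        ((∃ y : ι → ℝ, y ≠ 0 ∧ A *ᵥ y = 0) → 0 < (faddeev G k).trace)) := by
    intro k
    induction k with
    | zero =>
      left
      simp only [elemSum_zero, Nat.factorial_zero, Nat.cast_one, mul_one, diagonal_one, map_one,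
        faddeev]
      exact ⟨trivial, one_pos⟩
    | succ k ih =>
      rcases ih with ⟨h1, h2⟩ | ⟨h1, h2⟩
      · have hGN : c (G * faddeev G k) = φ (diagonal fun i =>
            l i * ((k.factorial : ℝ) * elemSum l (Finset.univ.erase i) k)) := by
          rw [map_mul, hφ, h1, ← map_mul, diagonal_mul_diagonal]
        have htr : ((G * faddeev G k).trace : ℝ)
            = (k + 1).factorial * elemSum l Finset.univ (k + 1) := by
          rw [← hctr, hGN, hφtr, trace_diagonal, Nat.factorial_succ, Nat.cast_mul, mul_comm
            ((k + 1 : ℕ) : ℝ), mul_assoc, Nat.cast_add_one, ← sum_mul_elemSum_erase,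
            Finset.mul_sum]
          exact Finset.sum_congr rfl fun i _ => by ring
        by_cases hpos : 0 < (G * faddeev G k).trace
        · left
          have he : 0 < elemSum l Finset.univ (k + 1) := by
            have : (0 : ℝ) < (G * faddeev G k).trace := by exact_mod_cast hpos
            rw [htr] at this
            exact pos_of_mul_pos_right this (by positivity)
          refine ⟨?_, he⟩
          rw [faddeev, if_pos hpos, map_sub, map_zsmul, map_zsmul, map_one, hGN,
            ← map_one φ, ← map_zsmul, ← map_zsmul, ← map_sub]
          congr 1
          ext i j
          rw [Matrix.sub_apply, Matrix.smul_apply, Matrix.smul_apply]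
          by_cases hij : i = j
          · subst hij
            rw [Matrix.one_apply_eq, diagonal_apply_eq, diagonal_apply_eq, zsmul_eq_mul,
              zsmul_eq_mul, htr, elemSum_succ_eq_erase (l := l) (Finset.mem_univ i) k,
              Nat.factorial_succ]
            push_cast
            ring
          · simp [hij]
        · right
          have hzero : (G * faddeev G k).trace = 0 := by
            refine le_antisymm (not_lt.1 hpos) ?_
            have : (0 : ℝ) ≤ (G * faddeev G k).trace := by
              rw [htr]
              exact mul_nonneg (by positivity) (elemSum_nonneg hl _ _)
            exact_mod_cast this
          rw [faddeev, if_neg hpos]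
          constructor
          · apply hcinj
            -- The trace is a sum of nonnegative eigenvalues of `G * faddeev G k`, so if it
            -- vanishes, each of them does.
            have hsum : ∑ i, l i * ((k.factorial : ℝ) * elemSum l (Finset.univ.erase i) k) = 0 := by
              rw [← trace_diagonal, ← hφtr, ← hGN, hctr, hzero, Int.cast_zero]
            rw [Finset.sum_eq_zero_iff_of_nonneg fun i _ => mul_nonneg (hl i)
              (mul_nonneg (by positivity) (elemSum_nonneg hl _ _))] at hsum
            rw [hGN, map_zero, ← map_zero φ]
            congr 1
            ext i j
            by_cases hij : i = j
            · subst hij; simpa using hsum i (Finset.mem_univ i)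
            · simp [hij]
          · intro hy
            obtain ⟨i, hi⟩ := hdet hy
            -- An index with `l i = 0` contributes positively: removing a zero eigenvalue does not
            -- change `e_k`, which is positive.
            have : (0 : ℝ) < (faddeev G k).trace := by
              rw [← hctr, h1, hφtr, trace_diagonal]
              refine Finset.sum_pos' (fun i _ => mul_nonneg (by positivity)
                (elemSum_nonneg hl _ _)) ⟨i, Finset.mem_univ i, mul_pos (by positivity) ?_⟩
              cases k with
              | zero => rw [elemSum_zero]; exact one_pos
              | succ k =>
                rw [elemSum_succ_eq_erase (Finset.mem_univ i), hi, zero_mul, add_zero] at h2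
                exact h2
            exact_mod_cast this
      · right
        rw [faddeev, if_neg (by simp [h1])]
        exact ⟨h1, h2⟩
  rcases main (Fintype.card ι) with ⟨h1, h2⟩ | h
  -- If the recursion never stopped, `e_n > 0` for all `n` eigenvalues. The final matrix is zero
  -- since only `n - 1` eigenvalues remain after removing one, and a kernel vector would force `e_n
  -- = 0`.
  · have h0 : ∀ i, elemSum l (Finset.univ.erase i) (Fintype.card ι) = 0 := by
      intro i
      have : (Finset.univ.erase i).card < Fintype.card ι :=
        Finset.card_erase_lt_of_mem (Finset.mem_univ i)
      rw [elemSum, Finset.powersetCard_eq_empty.2 this, Finset.sum_empty]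
    have hN : faddeev G (Fintype.card ι) = 0 := by
      apply hcinj
      rw [h1, map_zero]
      simp [h0]
    rw [hN]
    refine ⟨mul_zero _, fun hy => ?_⟩
    obtain ⟨i, hi⟩ := hdet hy
    exfalso
    obtain ⟨n, hn⟩ : ∃ n, Fintype.card ι = n + 1 :=
      Nat.exists_eq_succ_of_ne_zero (Fintype.card_pos_iff.2 ⟨i⟩).ne'
    rw [hn] at h2
    have h0i := h0 i
    rw [hn] at h0i
    rw [elemSum_succ_eq_erase (Finset.mem_univ i), h0i, hi] at h2
    simp at h2
  · exact h

end FaddeevLeVerrier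

/-! ### Rounding a fractional division

A division `X i / D`, `i < m`, gives the first agent the fraction `X i / D` of item `i`. The values
of the agents are `f₁ i k` and `f₂ i k`. -/

section Division

open Finset

/-- Item `i` is divided between the agents. -/
def IsSplit (X : ℕ → ℤ) (D : ℤ) (i : ℕ) : Prop := 0 < X i * (D - X i)

instance (X : ℕ → ℤ) (D : ℤ) : DecidablePred (IsSplit X D) := fun i =>
  inferInstanceAs (Decidable (0 < X i * (D - X i)))

/-- Both shares are worth the same in every dimension, except that the first agent may prefer the
first share in dimension `0`. -/
structure IsHalving (m L : ℕ) (f₁ f₂ : ℕ → ℕ → ℤ) (X : ℕ → ℤ) (D : ℤ) : Prop where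
  pos : 0 < D
  nonneg : ∀ i < m, 0 ≤ X i
  le : ∀ i < m, X i ≤ D
  first : 0 ≤ ∑ i ∈ range m, f₁ i 0 * (2 * X i - D)
  eq₁ : ∀ k < L, ∑ i ∈ range m, f₁ i (k + 1) * (2 * X i - D) = 0
  eq₂ : ∀ k < L, ∑ i ∈ range m, f₂ i k * (2 * X i - D) = 0

/-- The directions in which the divided items can be moved. -/
structure IsDirection {R : Type*} [CommRing R] (m L : ℕ) (f₁ f₂ : ℕ → ℕ → ℤ) (X : ℕ → ℤ) (D : ℤ)
    (y : ℕ → R) : Prop where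
  eq₁ : ∀ k < L, ∑ i ∈ range m, (f₁ i (k + 1) : R) * y i = 0
  eq₂ : ∀ k < L, ∑ i ∈ range m, (f₂ i k : R) * y i = 0
  zero : ∀ i < m, ¬ IsSplit X D i → y i = 0

/-- No direction is left. -/
def IsVertex (m L : ℕ) (f₁ f₂ : ℕ → ℕ → ℤ) (X : ℕ → ℤ) (D : ℤ) : Prop :=
  ∀ y : ℕ → ℝ, IsDirection m L f₁ f₂ X D y → ∀ i < m, y i = 0

/-- The number of items that are not divided. -/
def numWhole (m : ℕ) (X : ℕ → ℤ) (D : ℤ) : ℕ := #{i ∈ range m | ¬ IsSplit X D i}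

/-- How far `X i` can move in the direction of the sign of `y i`. -/
def room (X : ℕ → ℤ) (D : ℤ) (y : ℕ → ℤ) (i : ℕ) : ℤ := if 0 < y i then D - X i else X i

/-- `num / den` is the largest step in direction `y` that the first `n` items allow. -/
structure IsStep (X : ℕ → ℤ) (D : ℤ) (y : ℕ → ℤ) (n : ℕ) (num den : ℤ) : Prop where
  num_nonneg : 0 ≤ num
  den_nonneg : 0 ≤ den
  le : ∀ i < n, num * |y i| ≤ den * room X D y i
  attained : (num = 1 ∧ den = 0) ∨ ∃ q < n, 0 < den ∧ num = room X D y q ∧ den = |y q|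

variable {m L : ℕ} {f₁ f₂ : ℕ → ℕ → ℤ} {X y : ℕ → ℤ} {D num den : ℤ}

theorem IsHalving.isSplit_iff (h : IsHalving m L f₁ f₂ X D) {i : ℕ} (hi : i < m) :
    IsSplit X D i ↔ X i ≠ 0 ∧ X i ≠ D := by
  have h1 := h.nonneg i hi
  have h2 := h.le i hi
  unfold IsSplit
  constructor
  · intro hp
    constructor <;> intro h0 <;> simp [h0] at hp
  · rintro ⟨h3, h4⟩
    exact mul_pos (lt_of_le_of_ne h1 (Ne.symm h3)) (sub_pos.2 (lt_of_le_of_ne h2 h4))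

theorem IsHalving.room_nonneg (h : IsHalving m L f₁ f₂ X D) {i : ℕ} (hi : i < m) :
    0 ≤ room X D y i := by
  unfold room
  have h1 := h.nonneg i hi
  have h2 := h.le i hi
  split_ifs <;> omega

theorem IsHalving.room_le (h : IsHalving m L f₁ f₂ X D) {i : ℕ} (hi : i < m) :
    room X D y i ≤ D := by
  unfold room
  have h1 := h.nonneg i hi
  have h2 := h.le i hi
  split_ifs <;> omega

theorem IsStep.zero : IsStep X D y 0 1 0 :=
  ⟨by norm_num, le_rfl, fun i hi => absurd hi (Nat.not_lt_zero i), Or.inl ⟨rfl, rfl⟩⟩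

theorem IsStep.succ_of_le {n : ℕ} (h : IsStep X D y n num den)
    (hn : num * |y n| ≤ den * room X D y n) : IsStep X D y (n + 1) num den := by
  refine ⟨h.1, h.2, fun i hi => ?_, h.4.imp id fun ⟨q, hq, h'⟩ => ⟨q, by omega, h'⟩⟩
  rcases Nat.lt_succ_iff_lt_or_eq.1 hi with hi | rfl
  · exact h.le i hi
  · exact hn

/-- Item `n` is now the bottleneck. Ratios are compared by cross multiplication; the old `num` is
positive and can be cancelled. -/
theorem IsStep.succ_of_lt {n : ℕ} (h : IsStep X D y n num den)
    (hr : ∀ i ≤ n, 0 ≤ room X D y i)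
    (hn : den * room X D y n < num * |y n|) :
    IsStep X D y (n + 1) (room X D y n) |y n| := by
  have hrn := hr n le_rfl
  have hlhs : 0 ≤ den * room X D y n := mul_nonneg h.den_nonneg hrn
  have hy : 0 < |y n| := pos_of_mul_pos_right (hlhs.trans_lt hn) h.num_nonneg
  have hnum : 0 < num := pos_of_mul_pos_left (hlhs.trans_lt hn) hy.le
  refine ⟨hrn, hy.le, fun i hi => ?_, Or.inr ⟨n, by omega, hy, rfl, rfl⟩⟩
  rcases Nat.lt_succ_iff_lt_or_eq.1 hi with hi | rfl
  · have h1 := h.le i hi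
    refine le_of_mul_le_mul_left ?_ hnum
    calc num * (room X D y n * |y i|) = (num * |y i|) * room X D y n := by ring
      _ ≤ (den * room X D y i) * room X D y n := mul_le_mul_of_nonneg_right h1 hrn
      _ = (den * room X D y n) * room X D y i := by ring
      _ ≤ (num * |y n|) * room X D y i := mul_le_mul_of_nonneg_right hn.le (hr i (by omega))
      _ = _ := by ring
  · rw [mul_comm]

/-- `den = 0` encodes an infinite step, which only the zero direction admits. -/
theorem IsStep.den_pos (h : IsStep X D y m num den) {i : ℕ} (hi : i < m) (hy : y i ≠ 0) :
    0 < den := by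
  rcases h.attained with ⟨h1, h2⟩ | ⟨q, -, hq, -⟩
  · have := h.le i hi
    rw [h1, h2, one_mul, zero_mul] at this
    exact absurd (abs_nonpos_iff.1 this) hy
  · exact hq

theorem IsStep.shift_nonneg (h : IsStep X D y m num den) (hX : IsHalving m L f₁ f₂ X D)
    {i : ℕ} (hi : i < m) : 0 ≤ X i * den + num * y i := by
  have h1 := h.le i hi
  have h2 := h.num_nonneg
  have h3 := h.den_nonneg
  have h4 := hX.nonneg i hi
  unfold room at h1
  split_ifs at h1 with hy
  · positivity
  · rw [abs_of_nonpos (not_lt.1 hy)] at h1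
    linarith

theorem IsStep.shift_le (h : IsStep X D y m num den) (hX : IsHalving m L f₁ f₂ X D)
    {i : ℕ} (hi : i < m) : X i * den + num * y i ≤ D * den := by
  have h1 := h.le i hi
  have h2 := h.num_nonneg
  have h3 := h.den_nonneg
  unfold room at h1
  split_ifs at h1 with hy
  · rw [abs_of_pos hy] at h1
    linarith
  · have h4 := mul_le_mul_of_nonneg_right (hX.le i hi) h3
    have h5 := mul_nonpos_of_nonneg_of_nonpos h2 (not_lt.1 hy)
    linarith

/-- The forms are linear, so the step adds `2 * num` times their value on `y`, which is zero, or
nonnegative for the objective. Multiplying everything by `den` clears the denominator of the step.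
-/
theorem IsHalving.shift (hX : IsHalving m L f₁ f₂ X D) (hy : IsDirection m L f₁ f₂ X D y)
    (hf : 0 ≤ ∑ i ∈ range m, f₁ i 0 * y i) (h : IsStep X D y m num den) (hden : 0 < den) :
    IsHalving m L f₁ f₂ (fun i => X i * den + num * y i) (D * den) := by
  have hs : ∀ f : ℕ → ℤ, ∑ i ∈ range m, f i * (2 * (X i * den + num * y i) - D * den)
      = den * ∑ i ∈ range m, f i * (2 * X i - D) + 2 * num * ∑ i ∈ range m, f i * y i := by
    intro f
    rw [mul_sum, mul_sum, ← sum_add_distrib]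
    exact sum_congr rfl fun i _ => by ring
  refine ⟨mul_pos hX.pos hden, fun i hi => h.shift_nonneg hX hi, fun i hi => h.shift_le hX hi,
    ?_, fun k hk => ?_, fun k hk => ?_⟩
  · rw [hs fun i => f₁ i 0]
    exact add_nonneg (mul_nonneg hden.le hX.first) (mul_nonneg (by linarith [h.num_nonneg]) hf)
  · have h1 := hy.eq₁ k hk
    simp only [Int.cast_id] at h1
    rw [hs fun i => f₁ i (k + 1), hX.eq₁ k hk, h1, mul_zero, mul_zero, add_zero]
  · have h1 := hy.eq₂ k hk
    simp only [Int.cast_id] at h1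
    rw [hs fun i => f₂ i k, hX.eq₂ k hk, h1, mul_zero, mul_zero, add_zero]

/-- Whole items stay whole because `y` vanishes there. The item `q` that attains the bound reaches
`0` or the new denominator, and it was split before because `y q ≠ 0`. -/
theorem IsHalving.numWhole_shift (hX : IsHalving m L f₁ f₂ X D)
    (hy : IsDirection m L f₁ f₂ X D y) (hf : 0 ≤ ∑ i ∈ range m, f₁ i 0 * y i)
    (h : IsStep X D y m num den) (hden : 0 < den) :
    numWhole m X D + 1 ≤ numWhole m (fun i => X i * den + num * y i) (D * den) := by
  have hX' := hX.shift hy hf h hden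
  obtain ⟨q, hq, -, hnum, hd⟩ : ∃ q < m, 0 < den ∧ num = room X D y q ∧ den = |y q| :=
    h.attained.resolve_left fun h' => hden.ne' h'.2
  have hyq : y q ≠ 0 := fun h0 => by simp [hd, h0] at hden
  have hsplit : IsSplit X D q := by
    by_contra hc
    exact hyq (hy.zero q hq hc)
  rw [numWhole, numWhole, ← card_insert_of_notMem (a := q) (by simp [hsplit])]
  refine card_le_card fun i hi => ?_
  rw [mem_insert, mem_filter, mem_range] at hi
  rw [mem_filter, mem_range]
  rcases hi with rfl | ⟨him, hi⟩
  · refine ⟨hq, ?_⟩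
    rw [hX'.isSplit_iff hq, not_and_or, not_not, not_not]
    unfold room at hnum
    split_ifs at hnum with hpos
    · right
      rw [hd, hnum, abs_of_pos hpos]
      ring
    · left
      rw [hd, hnum, abs_of_nonpos (not_lt.1 hpos)]
      ring
  · refine ⟨him, ?_⟩
    have h0 := hy.zero i him hi
    rw [hX.isSplit_iff him, not_and_or, not_not, not_not] at hi
    rw [hX'.isSplit_iff him, not_and_or, not_not, not_not, h0]
    rcases hi with hi | hi <;> simp [hi]

/-- The Gram matrix of the linear forms that have to vanish on `2 * X i - D`. -/
def halvingGram (L : ℕ) (f₁ f₂ : ℕ → ℕ → ℤ) (i j : ℕ) : ℤ :=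
  ∑ k ∈ range L, (f₁ i (k + 1) * f₁ j (k + 1) + f₂ i k * f₂ j k)

/-- The Gram matrix of the linear forms that directions have to annihilate. -/
def directionGram (L : ℕ) (f₁ f₂ : ℕ → ℕ → ℤ) (X : ℕ → ℤ) (D : ℤ) (i j : ℕ) : ℤ :=
  halvingGram L f₁ f₂ i j + if i = j ∧ ¬ IsSplit X D i then 1 else 0

-- The Gram matrix is `Aᵀ * A`, where the kernel of `A` consists of the directions: besides the
-- balance equations, `A` has a unit row for every whole item. Over the reals `Aᵀ * A * M = 0`
-- implies `A * M = 0`, so every column of the final matrix is a direction. A positive trace gives a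
-- positive diagonal entry and thus a nonzero column.
open Matrix in
theorem faddeev_directionGram_spec (m L : ℕ) (f₁ f₂ : ℕ → ℕ → ℤ) (X : ℕ → ℤ) (D : ℤ)
    (N : ℕ → ℕ → ℤ)
    (hN : ∀ i j : Fin m, N i j
      = faddeev (.of fun i j : Fin m => directionGram L f₁ f₂ X D i j) m i j) :
    (∀ p < m, IsDirection m L f₁ f₂ X D fun i => N i p) ∧
      (¬ IsVertex m L f₁ f₂ X D → ∃ j < m, 0 < N j j) := by
  set G : Matrix (Fin m) (Fin m) ℤ := .of fun i j : Fin m => directionGram L f₁ f₂ X D i j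
    with hGdef
  let A : Matrix ((Fin L ⊕ Fin L) ⊕ Fin m) (Fin m) ℝ := .of fun r i =>
    Sum.elim (Sum.elim (fun k : Fin L => (f₁ i (k + 1) : ℝ)) (fun k : Fin L => (f₂ i k : ℝ)))
      (fun j : Fin m => if j = i ∧ ¬ IsSplit X D j then 1 else 0) r
  have hA : ∀ y : ℕ → ℝ, A *ᵥ (fun i : Fin m => y i) = 0 ↔ IsDirection m L f₁ f₂ X D y := by
    intro y
    have hz : ∀ j : Fin m, (A *ᵥ (fun i : Fin m => y i)) (Sum.inr j)
        = if IsSplit X D j then 0 else y j := by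
      intro j
      simp only [A, mulVec, dotProduct, of_apply, Sum.elim_inr]
      rw [sum_eq_single j]
      · by_cases h : IsSplit X D j <;> simp [h]
      · intro i _ hij
        simp [hij.symm]
      · simp
    have h1 : ∀ k : Fin L, (A *ᵥ (fun i : Fin m => y i)) (Sum.inl (Sum.inl k))
        = ∑ i ∈ range m, (f₁ i (k + 1) : ℝ) * y i := by
      intro k
      rw [sum_range]
      rfl
    have h2 : ∀ k : Fin L, (A *ᵥ (fun i : Fin m => y i)) (Sum.inl (Sum.inr k))
        = ∑ i ∈ range m, (f₂ i k : ℝ) * y i := by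
      intro k
      rw [sum_range]
      rfl
    constructor
    · intro h
      refine ⟨fun k hk => ?_, fun k hk => ?_, fun i hi hs => ?_⟩
      · rw [← h1 ⟨k, hk⟩, h]; rfl
      · rw [← h2 ⟨k, hk⟩, h]; rfl
      · have := hz ⟨i, hi⟩
        rw [h, if_neg hs] at this
        exact this.symm
    · intro h
      funext r
      rcases r with (k | k) | j
      · rw [h1]; exact h.eq₁ k k.2
      · rw [h2]; exact h.eq₂ k k.2
      · rw [hz]
        split_ifs with hs
        · rfl
        · exact h.zero j j.2 hs
  have hG : G.map (Int.cast : ℤ → ℝ) = Aᵀ * A := by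
    ext i j
    simp only [hGdef, directionGram, halvingGram, map_apply, of_apply, mul_apply, transpose_apply,
      Fintype.sum_sum_type, A, Sum.elim_inl, Sum.elim_inr, sum_range, Int.cast_add, Int.cast_sum,
      Int.cast_mul, sum_add_distrib]
    congr 1
    rw [sum_eq_single i]
    · by_cases hs : IsSplit X D i <;> by_cases hij : i = j <;>
        simp [hs, hij, Fin.val_inj]
    · intro k _ hk
      simp [hk]
    · simp
  obtain ⟨h1, h2⟩ := faddeev_spec A G hG
  rw [Fintype.card_fin] at h1 h2
  have hAN : A * (faddeev G m).map (Int.cast : ℤ → ℝ) = 0 := by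
    rw [← conjTranspose_mul_self_mul_eq_zero, conjTranspose_eq_transpose_of_trivial, ← hG]
    have := congrArg (fun M => M.map (Int.castRingHom ℝ)) h1
    rw [Matrix.map_mul] at this
    simpa using this
  constructor
  · intro p hp
    have hcol : IsDirection m L f₁ f₂ X D fun i => (N i p : ℝ) := by
      rw [← hA]
      funext r
      have := congrFun (congrFun hAN r) ⟨p, hp⟩
      rw [mul_apply] at this
      simp only [mulVec, dotProduct, Pi.zero_apply]
      refine Eq.trans (sum_congr rfl fun i _ => ?_) this
      rw [map_apply, ← hN i ⟨p, hp⟩]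
    refine ⟨fun k hk => ?_, fun k hk => ?_, fun i hi hs => ?_⟩
    · exact_mod_cast hcol.eq₁ k hk
    · exact_mod_cast hcol.eq₂ k hk
    · exact_mod_cast hcol.zero i hi hs
  · intro hv
    unfold IsVertex at hv
    push Not at hv
    obtain ⟨y, hy, i, hi, hne⟩ := hv
    have hpos := h2 ⟨fun i => y i, fun h0 => hne (congrFun h0 ⟨i, hi⟩), (hA y).2 hy⟩
    obtain ⟨j, -, hj⟩ := exists_lt_of_sum_lt (s := univ) (f := fun _ : Fin m => (0 : ℤ))
      (g := fun j => faddeev G m j j) (by simpa [trace] using hpos)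
    exact ⟨j, j.2, by rwa [hN j j]⟩

/-- Dimension count: more unknowns than the `(L - 1) + L` equations give a nonzero solution on the
split items, which extends by zero to a direction. -/
theorem IsVertex.card_split_le (h : IsVertex m L f₁ f₂ X D) (h0 : ∀ i < m, f₁ i L = 0) :
    #{i ∈ range m | IsSplit X D i} ≤ 2 * L - 1 := by
  set S := {i ∈ range m | IsSplit X D i} with hS
  by_contra hc
  let T : (S → ℝ) →ₗ[ℝ] (Fin (L - 1) ⊕ Fin L → ℝ) :=
    LinearMap.pi fun r => Sum.elim
      (fun k : Fin (L - 1) => ∑ i : S, (f₁ i (k + 1) : ℝ) • LinearMap.proj i)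
      (fun k : Fin L => ∑ i : S, (f₂ i k : ℝ) • LinearMap.proj i) r
  have hker : LinearMap.ker T ≠ ⊥ := by
    apply LinearMap.ker_ne_bot_of_finrank_lt
    simp only [Module.finrank_pi, Fintype.card_sum, Fintype.card_fin, Fintype.card_coe]
    omega
  obtain ⟨y, hy, hy0⟩ := Submodule.exists_mem_ne_zero_of_ne_bot hker
  rw [LinearMap.mem_ker] at hy
  set z : ℕ → ℝ := fun i => if hi : i ∈ S then y ⟨i, hi⟩ else 0 with hz
  have hsum : ∀ f : ℕ → ℝ, ∑ i ∈ range m, f i * z i = ∑ i : S, f i * y i := by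
    intro f
    rw [← sum_subset (filter_subset (IsSplit X D) (range m)), ← hS, ← sum_coe_sort S]
    · exact sum_congr rfl fun i _ => by simp [hz]
    · intro i _ hi
      simp only [hz]
      rw [dif_neg hi, mul_zero]
  apply hy0
  funext i
  have him : (i : ℕ) < m := mem_range.1 (mem_filter.1 i.2).1
  have := h z ⟨fun k hk => ?_, fun k hk => ?_, fun j _ hj => ?_⟩ i him
  · simpa [hz] using this
  · rcases Nat.lt_or_ge k (L - 1) with hk' | hk'
    · rw [hsum fun i => (f₁ i (k + 1) : ℝ)]
      simpa [T] using congrFun hy (Sum.inl ⟨k, hk'⟩)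
    -- The last equation of the first agent refers to a dimension beyond the instance; its
    -- coefficients are zero by `h0`, which is why it is not counted in `T`.
    · obtain rfl : L = k + 1 := by omega
      exact sum_eq_zero fun i hi => by rw [h0 i (mem_range.1 hi), Int.cast_zero, zero_mul]
  · rw [hsum fun i => (f₂ i k : ℝ)]
    simpa [T] using congrFun hy (Sum.inr ⟨k, hk⟩)
  · simp only [hz]
    rw [dif_neg]
    exact fun h' => hj (mem_filter.1 h').2

theorem card_split_le_of_numWhole (h : m ≤ numWhole m X D ∨ IsVertex m L f₁ f₂ X D)
    (h0 : ∀ i < m, f₁ i L = 0) : #{i ∈ range m | IsSplit X D i} ≤ 2 * L - 1 := by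
  rcases h with h | h
  · have : #{i ∈ range m | IsSplit X D i} + numWhole m X D = m := by
      rw [numWhole, card_filter_add_card_filter_not, card_range]
    omega
  · exact h.card_split_le h0

end Division

/-- The bundles that arise when every item goes to the agent with the larger share. -/
def roundedAllocation (I : Instance 2) (X : ℕ → ℤ) (D : ℤ) : Allocation I where
  bundle i := {g | 0 < 2 * X g - D ↔ i = 0}
  disjoint := by
    intro i i' h
    rw [Finset.disjoint_left]
    intro g hg hg'
    simp only [Finset.mem_filter, Finset.mem_univ, true_and] at hg hg'
    rw [hg] at hg'
    apply h
    omega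
  cover := by
    intro g
    by_cases h : 0 < 2 * X g - D
    · exact ⟨0, by simpa using h⟩
    · exact ⟨1, by simpa using h⟩

open Finset in
/-- Removing the divided items from the other bundle eliminates envy. -/
theorem setValue_sdiff_split_le (I : Instance 2) {X : ℕ → ℤ} {D : ℤ} {L : ℕ}
    {f₁ f₂ : ℕ → ℕ → ℤ} (h : IsHalving I.goods L f₁ f₂ X D) {i i' : Fin 2} (hi : i ≠ i')
    (k : Fin I.dims) (hbal : 0 ≤ ∑ g, (I.value i g k : ℤ) *
      ((if i = 0 then 1 else -1) * (2 * X g - D))) :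
    I.setValue i ((roundedAllocation I X D).bundle i' \
        ((roundedAllocation I X D).bundle i').filter fun g : Fin I.goods => IsSplit X D g) k
      ≤ I.setValue i ((roundedAllocation I X D).bundle i) k := by
  set A := roundedAllocation I X D with hA
  set R := A.bundle i' \ (A.bundle i').filter fun g : Fin I.goods => IsSplit X D g with hR
  -- The inequality holds item by item. Won items contribute `D`; split items lost contribute `0`,
  -- which suffices because the own share was at most half; whole items lost contribute `-D` on both
  -- sides.
  have hterm : ∀ g : Fin I.goods,
      (I.value i g k : ℤ) * ((if i = 0 then 1 else -1) * (2 * X g - D))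
      ≤ D * ((if g ∈ A.bundle i then (I.value i g k : ℤ) else 0)
        - (if g ∈ R then (I.value i g k : ℤ) else 0)) := by
    intro g
    have h1 := h.nonneg g g.2
    have h2 := h.le g g.2
    have hs := h.isSplit_iff g.2
    have hv : (0 : ℤ) ≤ I.value i g k := by positivity
    have hmem : ∀ j, g ∈ A.bundle j ↔ (0 < 2 * X g - D ↔ j = 0) := by
      intro j; simp [hA, roundedAllocation]
    have hmemR : g ∈ R ↔ g ∈ A.bundle i' ∧ ¬ IsSplit X D g := by
      simp only [hR, mem_sdiff, mem_filter]; tauto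
    have hgoal : (if i = 0 then 1 else -1) * (2 * X g - D)
        ≤ D * ((if g ∈ A.bundle i then 1 else 0) - (if g ∈ R then 1 else 0)) := by
      have hpos := h.pos
      simp only [hmemR, hmem, hs]
      obtain rfl | rfl : i = 0 ∨ i = 1 := by omega
      all_goals
        obtain rfl | rfl : i' = 0 ∨ i' = 1 := by omega
        all_goals simp at hi ⊢
        all_goals split_ifs <;> omega
    calc _ ≤ (I.value i g k : ℤ) * (D * ((if g ∈ A.bundle i then 1 else 0)
          - (if g ∈ R then 1 else 0))) := mul_le_mul_of_nonneg_left hgoal hv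
      _ = _ := by split_ifs <;> ring
  have hsum := hbal.trans (sum_le_sum fun g _ => hterm g)
  rw [← mul_sum, sum_sub_distrib, ← sum_filter, ← sum_filter, filter_mem_eq_inter,
    filter_mem_eq_inter, univ_inter, univ_inter] at hsum
  have h3 := (mul_nonneg_iff_of_pos_left h.pos).1 hsum
  rw [sub_nonneg] at h3
  unfold Instance.setValue
  exact_mod_cast h3

theorem Instance.toMem_one (I : Instance 2) (g k : ℕ) : I.toMem 1 g k
    = if h : g < I.goods ∧ k < I.dims then (I.value 0 ⟨g, h.1⟩ ⟨k, h.2⟩ : ℤ) else 0 := by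
  rfl

theorem Instance.toMem_two (I : Instance 2) (g k : ℕ) : I.toMem 2 g k
    = if h : g < I.goods ∧ k < I.dims then (I.value 1 ⟨g, h.1⟩ ⟨k, h.2⟩ : ℤ) else 0 := by
  rfl

-- The balance needed for the first agent is `first` in dimension `0` and `eq₁` in the others; for
-- the second agent it is `eq₂` with the sign reversed.
open Finset in
theorem roundedAllocation_strongSEF (I : Instance 2) {X : ℕ → ℤ} {D : ℤ}
    (h : IsHalving I.goods I.dims (I.toMem 1) (I.toMem 2) X D)
    (hcard : #{i ∈ range I.goods | IsSplit X D i} ≤ 2 * I.dims - 1) {c : ℕ}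
    (hc : 2 * (I.dims : ℤ) - 1 ≤ c) : (roundedAllocation I X D).StrongSEF c := by
  intro i i' hi
  refine ⟨((roundedAllocation I X D).bundle i').filter (fun g : Fin I.goods => IsSplit X D g), filter_subset _ _, ?_,
    fun k => setValue_sdiff_split_le I h hi k ?_⟩
  · have : #(((roundedAllocation I X D).bundle i').filter fun g : Fin I.goods => IsSplit X D g)
        ≤ #{i ∈ range I.goods | IsSplit X D i} := by
      refine card_le_card_of_injOn (fun g => (g : ℕ)) (fun g hg => ?_)
        (Fin.val_injective.injOn)
      rw [mem_coe, mem_filter] at hg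
      rw [mem_coe, mem_filter, mem_range]
      exact ⟨g.2, hg.2⟩
    omega
  · obtain rfl | rfl : i = 0 ∨ i = 1 := by omega
    · have hk : 0 ≤ ∑ g ∈ range I.goods, I.toMem 1 g k * (2 * X g - D) := by
        obtain ⟨k, hk⟩ := k
        cases k with
        | zero => exact h.first
        | succ k => exact (h.eq₁ k (by omega)).ge
      rw [sum_range] at hk
      simpa [Instance.toMem_one] using hk
    · have hk := h.eq₂ k k.2
      rw [sum_range] at hk
      refine (Eq.trans (Finset.sum_congr rfl fun g _ => ?_)
        ((Finset.sum_neg_distrib _).trans (neg_eq_zero.2 hk))).ge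
      simp [Instance.toMem_two, ← mul_neg]

/-! ### Loops that compute sums and fill matrices -/

theorem writes_forLoop (x : ℕ) (c : ℤ) (p : Program) :
    (forLoop x c p).writes = x :: (p.writes ++ [x]) := rfl

/-- Store the sum of the values of `term` for `x = 0, …, n - 1` in row `i`, column `j` of
array `a`. -/
def sumLoop (x : ℕ) (c : ℤ) (a : ℕ) (i j term : Expr) : Program :=
  .seq (.write a i j (.const 0)) (forLoop x c (.write a i j (.add (.read a i j) term)))

section Loops

open Finset

variable {N β : ℕ} {p : Program} {μ : Mem} {K : ℕ}

/-- The accumulator lives in a memory cell, so `hT` has to bound all partial sums. -/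
theorem Runs.sumLoop {x a : ℕ} {c : ℤ} {ei ej term : Expr} {i j : ℕ} (T : ℕ → ℤ)
    (hμ : Bounded β μ) (hK : μ 0 0 c.toNat = K) (hN : K ≤ N) (hβ : (K : ℤ) < 2 ^ β)
    (hxa : x ≠ a) (hx0 : x ≠ 0) (ha0 : a ≠ 0)
    (hij : ∀ ν : Mem, (∀ b, b ≠ x → b ≠ a → ν b = μ b) →
      (ei.eval ν).toNat = i ∧ (ej.eval ν).toNat = j)
    (hterm : ∀ n < K, ∀ ν : Mem, (∀ b, b ≠ x → b ≠ a → ν b = μ b) → ν x 0 0 = n →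
      term.eval ν = T n)
    (hT : ∀ n ≤ K, |∑ l ∈ range n, T l| < 2 ^ β) :
    Runs N β (sumLoop x c a ei ej term) μ fun ν => ν a i j = ∑ l ∈ range K, T l ∧
      ∀ i' j', ¬ (i' = i ∧ j' = j) → ν a i' j' = μ a i' j' := by
  have h0 := hij μ fun _ _ _ => rfl
  refine Runs.seq (R := fun ν => ν = μ.set a i j 0) (Runs.write hμ (by simp [Expr.eval]) ?_) ?_
  · rw [h0.1, h0.2]; rfl
  rintro ν hν - rfl
  refine Runs.forLoop (fun n ν => ν a i j = ∑ l ∈ range n, T l ∧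
      ∀ i' j', ¬ (i' = i ∧ j' = j) → ν a i' j' = μ a i' j') hν ?_ hN hβ (by simpa [Program.writes])
    hx0 (by simpa [Program.writes] using ha0.symm) ?_ ?_ ?_
  · rw [Mem.set_of_ne ha0.symm, hK]
  · intro n ν z h
    rwa [Mem.set_of_ne hxa.symm]
  · refine ⟨by simp [Mem.set], fun i' j' h => ?_⟩
    simp only [Mem.set, true_and, if_neg h]
  · intro n hn ν hν hx hfr ⟨h1, h2⟩
    have hfr' : ∀ b, b ≠ x → b ≠ a → ν b = μ b := fun b hbx hba => by
      rw [hfr b hbx (by simpa [Program.writes] using hba), Mem.set_of_ne hba]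
    obtain ⟨hi, hj⟩ := hij ν hfr'
    have hev : (Expr.add (.read a ei ej) term).eval ν = ∑ l ∈ range (n + 1), T l := by
      rw [sum_range_succ]
      simp only [Expr.eval, hi, hj, h1, hterm n hn ν hfr' hx]
    refine Runs.write hν ?_ ?_
    · rw [hev]
      exact hT _ hn
    · rw [hev, hi, hj]
      refine ⟨by simp [Mem.set], fun i' j' h => ?_⟩
      simp only [Mem.set, true_and, if_neg h]
      exact h2 i' j' h

/-- The body may change only the current cell of array `a`, so entries already written survive.
Scratch arrays used by the body are unrestricted. -/
theorem Runs.fill {x y a : ℕ} (F : ℕ → ℕ → ℤ) (hμ : Bounded β μ) (hK : μ 0 0 0 = K)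
    (hN : K ≤ N) (hβ : (K : ℤ) < 2 ^ β) (hxy : x ≠ y) (hx : x ∉ p.writes) (hy : y ∉ p.writes)
    (h0 : 0 ∉ p.writes) (hx0 : x ≠ 0) (hy0 : y ≠ 0) (hxa : x ≠ a) (hya : y ≠ a)
    (hp : ∀ i < K, ∀ j < K, ∀ ν : Mem, Bounded β ν →
      (∀ b, b ≠ x → b ≠ y → b ∉ p.writes → ν b = μ b) → ν x 0 0 = i → ν y 0 0 = j →
      Runs N β p ν fun ν' => ν' a i j = F i j ∧
        ∀ i' j', ¬ (i' = i ∧ j' = j) → ν' a i' j' = ν a i' j') :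
    Runs N β (MDFA.forLoop x 0 (MDFA.forLoop y 0 p)) μ fun ν => ∀ i < K, ∀ j < K, ν a i j = F i j := by
  refine Runs.forLoop (c := 0) (fun n ν => ∀ i < n, ∀ j < K, ν a i j = F i j) hμ hK hN hβ
    (by simp [writes_forLoop, hxy, hx]) hx0 (by simp [writes_forLoop, hy0.symm, h0]) ?_ ?_ ?_
  · intro n ν z h
    rwa [Mem.set_of_ne hxa.symm]
  · intro i hi
    omega
  intro i hi ν hν hνx hfr hI
  refine (Runs.forLoop (K := K) (c := 0) (fun n ν => (∀ i' < i, ∀ j < K, ν a i' j = F i' j) ∧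
    ∀ j < n, ν a i j = F i j) hν ?_ hN hβ hy hy0 h0 ?_ ⟨hI, by omega⟩ ?_).mono ?_
  · rw [hfr 0 hx0.symm (by simp [writes_forLoop, hy0.symm, h0])]
    exact hK
  · intro n ν z h
    rwa [Mem.set_of_ne hya.symm]
  · intro j hj ν' hν' hν'y hfr' ⟨h1, h2⟩
    refine (hp i hi j hj ν' hν' ?_ ?_ hν'y).mono ?_
    · intro b hbx hby hbp
      rw [hfr' b hby hbp, hfr b hbx (by simp [writes_forLoop, hby, hbp])]
    · rw [hfr' x hxy hx, hνx]
    · rintro ρ - - ⟨h3, h4⟩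
      refine ⟨fun i' hi' j' hj' => ?_, fun j' hj' => ?_⟩
      · rw [h4 i' j' (by omega), h1 i' hi' j' hj']
      · rcases Nat.lt_succ_iff_lt_or_eq.1 hj' with h | rfl
        · rw [h4 i j' (by omega), h2 j' h]
        · exact h3
  · rintro ρ - - ⟨h1, h2⟩ i' hi' j hj
    rcases Nat.lt_succ_iff_lt_or_eq.1 hi' with h | rfl
    · exact h1 i' h j hj
    · exact h2 j hj

end Loops

/-! ### The program -/

/-- The expression with value `1` if the variables `x` and `y` are equal and `0` otherwise. -/
def eqExpr (x y : ℕ) : Expr :=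
  .div (.const 1) (.add (.const 1) (.mul (.sub (var x) (var y)) (.sub (var x) (var y))))

/-- The expression that is positive if the item with number `x` is split. -/
def splitExpr (x : ℕ) : Expr :=
  .mul (.read 4 (var x) (.const 0)) (.sub (var 5) (.read 4 (var x) (.const 0)))

/-- Start with half of every item. -/
def initProg : Program :=
  .seq (assign 5 (.const 2)) (forLoop 22 0 (.write 4 (var 22) (.const 0) (.const 1)))

/-- Write `halvingGram` to array `6`. -/
def gramProg : Program :=
  forLoop 22 0 (forLoop 23 0 (sumLoop 24 1 6 (var 22) (var 23)
    (.add (.mul (.read 1 (var 22) (.add (var 24) (.const 1)))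
        (.read 1 (var 23) (.add (var 24) (.const 1))))
      (.mul (.read 2 (var 22) (var 24)) (.read 2 (var 23) (var 24))))))

/-- Write the product of `directionGram` and array `7` to array `8`. -/
def prodProg : Program :=
  forLoop 22 0 (forLoop 23 0 (.seq
    (sumLoop 24 0 8 (var 22) (var 23)
      (.mul (.read 6 (var 22) (var 24)) (.read 7 (var 24) (var 23))))
    (.cond (splitExpr 22) .nop (.write 8 (var 22) (var 23)
      (.add (.read 8 (var 22) (var 23)) (.read 7 (var 22) (var 23)))))))

/-- One step of the Faddeev–LeVerrier algorithm. -/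
def faddeevStep : Program :=
  .seq prodProg (.seq (sumLoop 22 0 9 (.const 0) (.const 0) (.read 8 (var 22) (var 22)))
    (.cond (var 9)
      (forLoop 22 0 (forLoop 23 0 (.write 7 (var 22) (var 23)
        (.sub (.mul (var 9) (eqExpr 22 23))
          (.mul (.add (var 21) (.const 1)) (.read 8 (var 22) (var 23)))))))
      .nop))

/-- Write the final matrix of the Faddeev–LeVerrier algorithm for `directionGram` to array `7`. -/
def faddeevProg : Program :=
  .seq (forLoop 22 0 (forLoop 23 0 (.write 7 (var 22) (var 23) (eqExpr 22 23))))
    (forLoop 21 0 faddeevStep)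

/-- Find a column with positive diagonal entry. -/
def pivotProg : Program :=
  .seq (assign 10 (.const 0))
    (forLoop 22 0 (.cond (.read 7 (var 22) (var 22)) (assign 10 (var 22)) .nop))

/-- Find the sign with which the column improves the objective. -/
def signProg : Program :=
  .seq (sumLoop 22 0 11 (.const 0) (.const 0)
      (.mul (.read 1 (var 22) (.const 0)) (.read 7 (var 22) (var 10))))
    (.cond (var 11) (assign 12 (.const 1)) (assign 12 (.const (-1))))

/-- Write the direction to array `15`, and its absolute value and the room to move of the current
item to the variables `16` and `17`. -/
def moveProg : Program :=
  .seq (.write 15 (var 22) (.const 0) (.mul (var 12) (.read 7 (var 22) (var 10))))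
    (.cond (.read 15 (var 22) (.const 0))
      (.seq (assign 16 (.read 15 (var 22) (.const 0)))
        (assign 17 (.sub (var 5) (.read 4 (var 22) (.const 0)))))
      (.seq (assign 16 (.sub (.const 0) (.read 15 (var 22) (.const 0))))
        (assign 17 (.read 4 (var 22) (.const 0)))))

/-- Find the largest feasible step. -/
def ratioProg : Program :=
  .seq (assign 13 (.const 1)) (.seq (assign 14 (.const 0)) (forLoop 22 0 (.seq moveProg
    (.cond (.sub (.mul (var 13) (var 16)) (.mul (var 14) (var 17)))
      (.seq (assign 13 (var 17)) (assign 14 (var 16))) .nop))))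

/-- Make the step. -/
def shiftProg : Program :=
  .cond (var 14)
    (.seq (forLoop 22 0 (.write 4 (var 22) (.const 0)
        (.add (.mul (.read 4 (var 22) (.const 0)) (var 14))
          (.mul (var 13) (.read 15 (var 22) (.const 0))))))
      (assign 5 (.mul (var 5) (var 14))))
    .nop

/-- Make one more item whole, if possible. -/
def wholeStep : Program :=
  .seq faddeevProg (.seq pivotProg (.seq signProg (.seq ratioProg shiftProg)))

/-- Give every item to the agent with the larger share. -/
def roundProg : Program :=
  forLoop 22 0 (.cond (.sub (.mul (.const 2) (.read 4 (var 22) (.const 0))) (var 5))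
    (.write 3 (var 22) (.const 0) (.const 0)) (.write 3 (var 22) (.const 0) (.const 1)))

/-- Compute a simultaneously envy-free allocation. -/
def halvingProg : Program :=
  .seq initProg (.seq gramProg (.seq (forLoop 20 0 wholeStep) roundProg))

/-! ### Correctness of the matrix computations -/

section Phases

open Finset

/-- The memory holds the input. -/
structure HoldsInput (m L : ℕ) (f₁ f₂ : ℕ → ℕ → ℤ) (μ : Mem) : Prop where
  goods : μ 0 0 0 = m
  dims : μ 0 0 1 = L
  fst : μ 1 = f₁
  snd : μ 2 = f₂

theorem HoldsInput.of_eq {m L : ℕ} {f₁ f₂ : ℕ → ℕ → ℤ} {μ ν : Mem}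
    (h : HoldsInput m L f₁ f₂ μ) (h0 : ν 0 = μ 0) (h1 : ν 1 = μ 1) (h2 : ν 2 = μ 2) :
    HoldsInput m L f₁ f₂ ν :=
  ⟨by rw [h0, h.goods], by rw [h0, h.dims], by rw [h1, h.fst], by rw [h2, h.snd]⟩

/-- The memory holds the current division and `halvingGram`. -/
structure HoldsDivision (m L : ℕ) (f₁ f₂ : ℕ → ℕ → ℤ) (X : ℕ → ℤ) (D : ℤ) (μ : Mem) : Prop
    extends HoldsInput m L f₁ f₂ μ where
  share : ∀ i < m, μ 4 i 0 = X i
  denom : μ 5 0 0 = D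
  gram : ∀ i < m, ∀ j < m, μ 6 i j = halvingGram L f₁ f₂ i j

theorem HoldsDivision.of_eq {m L : ℕ} {f₁ f₂ : ℕ → ℕ → ℤ} {X : ℕ → ℤ} {D : ℤ} {μ ν : Mem}
    (h : HoldsDivision m L f₁ f₂ X D μ) (h0 : ν 0 = μ 0) (h1 : ν 1 = μ 1) (h2 : ν 2 = μ 2)
    (h4 : ν 4 = μ 4) (h5 : ν 5 = μ 5) (h6 : ν 6 = μ 6) : HoldsDivision m L f₁ f₂ X D ν :=
  { h.toHoldsInput.of_eq h0 h1 h2 with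
    share := by rw [h4]; exact h.share
    denom := by rw [h5]; exact h.denom
    gram := by rw [h6]; exact h.gram }

/-- Numbers with `β` binary digits suffice for all intermediate results: `γ` bounds the entries
of `directionGram` and `q ^ m` those of the final Faddeev–LeVerrier matrix. -/
structure Fits (N β m L : ℕ) (f₁ f₂ : ℕ → ℕ → ℤ) (γ q : ℤ) : Prop where
  goods_le : m ≤ N
  goods_lt : (m : ℤ) < 2 ^ β
  dims_le : L ≤ N
  dims_lt : (L : ℤ) < 2 ^ β
  objective_le : ∀ i, |f₁ i 0| ≤ γ
  one_le : 1 ≤ γ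
  gram_lt : ∀ i j, ∀ n ≤ L, |halvingGram n f₁ f₂ i j| < γ
  growth : q = 2 * m ^ 2 * γ
  entry_lt : γ < 2 ^ β
  denom_lt : ∀ t ≤ m, 2 * (q ^ m) ^ t < 2 ^ β
  sum_lt : m * γ * q ^ m < 2 ^ β

variable {N β m L : ℕ} {f₁ f₂ : ℕ → ℕ → ℤ} {γ q : ℤ} {X : ℕ → ℤ} {D : ℤ} {μ : Mem}

theorem Fits.one_le_growth (h : Fits N β m L f₁ f₂ γ q) (hm : 0 < m) : 1 ≤ q := by
  rw [h.growth]
  have h1 : (1 : ℤ) ≤ m := by exact_mod_cast hm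
  have := h.one_le
  nlinarith [mul_le_mul h1 h1 (by norm_num) (by positivity)]

theorem Fits.abs_directionGram_le (h : Fits N β m L f₁ f₂ γ q) (i j : ℕ) :
    |directionGram L f₁ f₂ X D i j| ≤ γ := by
  have h1 := h.gram_lt i j L le_rfl
  rw [directionGram]
  rw [abs_lt] at h1
  rw [abs_le]
  split_ifs <;> constructor <;> omega

theorem abs_sum_range_le {m n : ℕ} (hn : n ≤ m) {f : ℕ → ℤ} {b : ℤ} (hb : 0 ≤ b)
    (hf : ∀ i < m, |f i| ≤ b) : |∑ i ∈ range n, f i| ≤ m * b := by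
  refine (abs_sum_le_sum_abs _ _).trans ?_
  refine (sum_le_card_nsmul _ _ b fun i hi => hf i ?_).trans ?_
  · have := mem_range.1 hi
    omega
  · rw [card_range, nsmul_eq_mul]
    exact mul_le_mul_of_nonneg_right (by exact_mod_cast hn) hb

/-- Entries of `G * faddeev G k` are at most `m * γ * q ^ k`. Its trace and its multiple by `k + 1 ≤
m` each cost another factor `m`, which gives the growth factor `2 * m ^ 2 * γ = q`. -/
theorem Fits.abs_faddeev_le (h : Fits N β m L f₁ f₂ γ q) (k : ℕ) (hk : k ≤ m) (i j : Fin m) :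
    |faddeev (.of fun i j : Fin m => directionGram L f₁ f₂ X D i j) k i j| ≤ q ^ k := by
  set G : Matrix (Fin m) (Fin m) ℤ := .of fun i j : Fin m => directionGram L f₁ f₂ X D i j
    with hG
  have hm : 0 < m := i.pos
  have hq := h.one_le_growth hm
  have hγ := h.one_le
  induction k generalizing i j with
  | zero =>
    by_cases hij : i = j <;> simp [faddeev, Matrix.one_apply, hij]
  | succ k ih =>
    have hqk : 0 < q ^ k := by positivity
    have hprod : ∀ i j, |(G * faddeev G k) i j| ≤ m * (γ * q ^ k) := by
      intro i j
      rw [Matrix.mul_apply]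
      refine (abs_sum_le_sum_abs _ _).trans ?_
      refine (sum_le_card_nsmul _ _ (γ * q ^ k) fun l _ => ?_).trans (by simp)
      rw [abs_mul]
      exact mul_le_mul (h.abs_directionGram_le _ _) (ih (by omega) l j) (abs_nonneg _)
        (by omega)
    rw [faddeev]
    split_ifs with htr
    · have h1 : |(G * faddeev G k).trace| ≤ m * (m * (γ * q ^ k)) := by
        rw [Matrix.trace]
        refine (abs_sum_le_sum_abs _ _).trans ?_
        exact (sum_le_card_nsmul _ _ _ fun l _ => hprod l l).trans (by simp)
      have h2 : |((G * faddeev G k).trace • (1 : Matrix (Fin m) (Fin m) ℤ)) i j|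
          ≤ m * (m * (γ * q ^ k)) := by
        by_cases hij : i = j
        · simpa [hij] using h1
        · simp only [Matrix.smul_apply, Matrix.one_apply_ne hij, smul_zero, abs_zero]
          positivity
      have h3 : |((k + 1 : ℤ) • (G * faddeev G k)) i j| ≤ m * (m * (γ * q ^ k)) := by
        rw [Matrix.smul_apply, smul_eq_mul, abs_mul, abs_of_nonneg (by positivity)]
        exact mul_le_mul (by exact_mod_cast hk) (hprod i j) (abs_nonneg _) (by positivity)
      rw [Matrix.sub_apply]
      refine (abs_sub _ _).trans ((add_le_add h2 h3).trans (le_of_eq ?_))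
      rw [pow_succ, h.growth]
      ring
    · refine (ih (by omega) i j).trans ?_
      exact pow_le_pow_right₀ hq (by omega)

/-- The integer quotient of `1` by `1 + (i - j) ^ 2` is `1` exactly if `i = j`. -/
theorem eqExpr_eval {ν : Mem} {x y i j : ℕ} (hx : ν x 0 0 = i) (hy : ν y 0 0 = j) :
    (eqExpr x y).eval ν = if i = j then 1 else 0 := by
  simp only [eqExpr, Expr.eval, Int.toNat_zero, hx, hy]
  split_ifs with h
  · simp [h]
  · refine Int.ediv_eq_zero_of_lt (by norm_num) ?_
    have h' : (i : ℤ) - j ≠ 0 := by omega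
    have := mul_self_pos.2 h'
    linarith

theorem splitExpr_eval {ν : Mem} {x i : ℕ} (hx : ν x 0 0 = i) (hX : ν 4 i 0 = X i)
    (hD : ν 5 0 0 = D) : 0 < (splitExpr x).eval ν ↔ IsSplit X D i := by
  simp [splitExpr, Expr.eval, hx, hX, hD, IsSplit]

theorem Runs.gramProg (hμ : Bounded β μ) (hin : HoldsInput m L f₁ f₂ μ)
    (hf : Fits N β m L f₁ f₂ γ q) :
    Runs N β gramProg μ fun ν => ∀ i < m, ∀ j < m, ν 6 i j = halvingGram L f₁ f₂ i j := by
  refine Runs.fill _ hμ hin.goods hf.goods_le hf.goods_lt (by decide) (by decide) (by decide)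
    (by decide) (by decide) (by decide) (by decide) (by decide) ?_
  intro i hi j hj ν hν hfr hx hy
  have hfr0 := hfr 0 (by decide) (by decide) (by decide)
  have hfr1 := hfr 1 (by decide) (by decide) (by decide)
  have hfr2 := hfr 2 (by decide) (by decide) (by decide)
  have hin' := hin.of_eq hfr0 hfr1 hfr2
  refine Runs.sumLoop (K := L)
    (fun k => f₁ i (k + 1) * f₁ j (k + 1) + f₂ i k * f₂ j k) hν hin'.dims hf.dims_le
    hf.dims_lt (by decide) (by decide) (by decide) (fun ρ hρ => ?_) (fun n hn ρ hρ hn' => ?_)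
    (fun n hn => (hf.gram_lt i j n hn).trans hf.entry_lt)
  · simp [Expr.eval, hρ 22, hρ 23, hx, hy]
  · have e1 : ((n : ℤ) + 1).toNat = n + 1 := by omega
    simp [Expr.eval, hρ 22, hρ 23, hρ 1, hρ 2, hx, hy, hn', hin'.fst, hin'.snd, e1]

theorem Runs.prodProg (hμ : Bounded β μ) (hin : HoldsDivision m L f₁ f₂ X D μ)
    (hf : Fits N β m L f₁ f₂ γ q) {b : ℤ} (hb : ∀ i < m, ∀ j < m, |μ 7 i j| ≤ b)
    (hlt : m * (γ * b) < 2 ^ β) :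
    Runs N β prodProg μ fun ν => ∀ i < m, ∀ j < m,
      ν 8 i j = ∑ l ∈ range m, directionGram L f₁ f₂ X D i l * μ 7 l j := by
  refine Runs.fill _ hμ hin.goods hf.goods_le hf.goods_lt (by decide) (by decide) (by decide)
    (by decide) (by decide) (by decide) (by decide) (by decide) ?_
  intro i hi j hj ν hν hfr hx hy
  have h7 := hfr 7 (by decide) (by decide) (by decide)
  have hin' := hin.of_eq (hfr 0 (by decide) (by decide) (by decide))
    (hfr 1 (by decide) (by decide) (by decide)) (hfr 2 (by decide) (by decide) (by decide))
    (hfr 4 (by decide) (by decide) (by decide)) (hfr 5 (by decide) (by decide) (by decide))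
    (hfr 6 (by decide) (by decide) (by decide))
  have hb0 : 0 ≤ b := (abs_nonneg _).trans (hb i hi j hj)
  have hγ := hf.one_le
  -- Only `halvingGram` is stored, since it never changes. The diagonal correction of a whole item
  -- adds row `i` of the other factor, which is what the conditional write does.
  have hsum : ∑ l ∈ range m, directionGram L f₁ f₂ X D i l * μ 7 l j
      = ∑ l ∈ range m, halvingGram L f₁ f₂ i l * μ 7 l j
        + if IsSplit X D i then 0 else μ 7 i j := by
    have : ∀ l, directionGram L f₁ f₂ X D i l * μ 7 l j = halvingGram L f₁ f₂ i l * μ 7 l j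
        + if i = l then (if IsSplit X D i then 0 else μ 7 i j) else 0 := by
      intro l
      rw [directionGram, add_mul]
      congr 1
      by_cases hil : i = l
      · subst hil
        by_cases hs : IsSplit X D i <;> simp [hs]
      · simp [hil]
    rw [sum_congr rfl fun l _ => this l, sum_add_distrib, sum_ite_eq, if_pos (mem_range.2 hi)]
  refine Runs.seq (Runs.sumLoop (K := m) (i := i) (j := j)
    (fun l => halvingGram L f₁ f₂ i l * μ 7 l j) hν hin'.goods hf.goods_le
    hf.goods_lt (by decide) (by decide) (by decide) (fun ρ hρ => ?_) (fun n hn ρ hρ hn' => ?_)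
    (fun n hn => ?_)) ?_
  · simp [Expr.eval, hρ 22, hρ 23, hx, hy]
  · simp [Expr.eval, hρ 22, hρ 23, hρ 6, hρ 7, hx, hy, hn', hin'.gram i hi n hn, h7]
  · refine (abs_sum_range_le hn (b := γ * b) (by positivity) fun l hl => ?_).trans_lt hlt
    rw [abs_mul]
    exact mul_le_mul (hf.gram_lt i l L le_rfl).le (hb l hl j hj) (abs_nonneg _) (by omega)
  · rintro ρ hρ hfr' ⟨h1, h2⟩
    have hx' : ρ 22 0 0 = i := by rw [hfr' 22 (by decide), hx]
    have hy' : ρ 23 0 0 = j := by rw [hfr' 23 (by decide), hy]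
    have hs := splitExpr_eval (X := X) (D := D) hx'
      (by rw [hfr' 4 (by decide), hin'.share i hi]) (by rw [hfr' 5 (by decide), hin'.denom])
    refine Runs.cond hρ (fun hc => Runs.nop hρ ?_) fun hc => Runs.write hρ ?_ ?_
    · rw [hsum, if_pos (hs.1 hc), add_zero]
      exact ⟨h1, h2⟩
    all_goals
      have hev : (Expr.add (.read 8 (var 22) (var 23)) (.read 7 (var 22) (var 23))).eval ρ
          = ∑ l ∈ range m, directionGram L f₁ f₂ X D i l * μ 7 l j := by
        rw [hsum, if_neg fun h => absurd (hs.2 h) (not_lt.2 hc)]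
        simp [Expr.eval, hx', hy', h1, hfr' 7 (by decide), h7]
      rw [hev]
    · refine (abs_sum_range_le le_rfl (b := γ * b) (by positivity) fun l hl => ?_).trans_lt hlt
      rw [abs_mul]
      exact mul_le_mul (hf.abs_directionGram_le i l) (hb l hl j hj) (abs_nonneg _) (by omega)
    · simp only [Expr.eval, Int.toNat_zero, hx', hy', Int.toNat_natCast]
      refine ⟨by simp [Mem.set], fun i' j' h => ?_⟩
      simp only [Mem.set, true_and, if_neg h]
      exact h2 i' j' h

theorem Runs.faddeevProg (hμ : Bounded β μ) (hin : HoldsDivision m L f₁ f₂ X D μ)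
    (hf : Fits N β m L f₁ f₂ γ q) (hm : 0 < m) :
    Runs N β faddeevProg μ fun ν => ∀ i j : Fin m, ν 7 i j
      = faddeev (.of fun i j : Fin m => directionGram L f₁ f₂ X D i j) m i j := by
  set G : Matrix (Fin m) (Fin m) ℤ := .of fun i j : Fin m => directionGram L f₁ f₂ X D i j
    with hG
  have hq := hf.one_le_growth hm
  have hγ := hf.one_le
  have hβ : (1 : ℤ) < 2 ^ β := hγ.trans_lt hf.entry_lt
  have hqβ : ∀ k < m, q ^ (k + 1) < 2 ^ β := fun k hk => by
    have h1 := hf.denom_lt 1 (by omega)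
    have h2 : q ^ (k + 1) ≤ q ^ m := pow_le_pow_right₀ hq (by omega)
    have h3 : 0 < q ^ m := by positivity
    rw [pow_one] at h1
    linarith
  refine Runs.seq (Runs.fill (a := 7) (fun i j => if i = j then 1 else 0) hμ hin.goods hf.goods_le
    hf.goods_lt (by decide) (by decide) (by decide) (by decide) (by decide) (by decide)
    (by decide) (by decide) ?_) ?_
  · intro i hi j hj ν hν hfr hx hy
    refine Runs.write hν ?_ ?_
    · rw [eqExpr_eval hx hy]
      split_ifs
      · simpa using hβ
      · simp
    · rw [eqExpr_eval hx hy]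
      simp only [Expr.eval, Int.toNat_zero, hx, hy, Int.toNat_natCast]
      refine ⟨by simp [Mem.set], fun i' j' h => ?_⟩
      simp only [Mem.set, true_and, if_neg h]
  intro ν hν hfr h1
  have hin' := hin.of_eq (hfr 0 (by decide)) (hfr 1 (by decide)) (hfr 2 (by decide))
    (hfr 4 (by decide)) (hfr 5 (by decide)) (hfr 6 (by decide))
  refine Runs.forLoop (fun k ρ => ∀ i j : Fin m, ρ 7 i j = faddeev G k i j) hν hin'.goods
    hf.goods_le hf.goods_lt (by decide) (by decide) (by decide) ?_ ?_ ?_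
  · intro k ρ z h
    rwa [Mem.set_of_ne (by decide)]
  · intro i j
    rw [h1 i i.2 j j.2, faddeev, Matrix.one_apply]
    simp only [Fin.ext_iff]
  intro k hk ρ hρ hk' hfr' hI
  have hin'' := hin'.of_eq (hfr' 0 (by decide) (by decide)) (hfr' 1 (by decide) (by decide))
    (hfr' 2 (by decide) (by decide)) (hfr' 4 (by decide) (by decide))
    (hfr' 5 (by decide) (by decide)) (hfr' 6 (by decide) (by decide))
  have hb : ∀ i < m, ∀ j < m, |ρ 7 i j| ≤ q ^ k := fun i hi j hj => by
    rw [hI ⟨i, hi⟩ ⟨j, hj⟩]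
    exact hf.abs_faddeev_le k hk.le _ _
  have hqk : 0 < q ^ k := by positivity
  have hm1 : (1 : ℤ) ≤ m := by exact_mod_cast hm
  -- The trace is at most half of `q ^ (k + 1)`.
  have hstep : m * (m * (γ * q ^ k)) < 2 ^ β := by
    refine lt_of_le_of_lt ?_ (hqβ k hk)
    rw [pow_succ, hf.growth]
    have : (0 : ℤ) ≤ m * (m * (γ * (2 * m ^ 2 * γ) ^ k)) := by positivity
    linarith
  have hstep' : m * (γ * q ^ k) < 2 ^ β := lt_of_le_of_lt
    (le_mul_of_one_le_left (by positivity) hm1) hstep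
  refine Runs.seq (Runs.prodProg hρ hin'' hf hb hstep') ?_
  intro τ hτ hfrτ hH
  have hH' : ∀ i j : Fin m, τ 8 i j = (G * faddeev G k) i j := by
    intro i j
    rw [hH i i.2 j j.2, sum_range, Matrix.mul_apply]
    exact sum_congr rfl fun l _ => by rw [hI l j]; rfl
  have hHb : ∀ i < m, ∀ j < m, |τ 8 i j| ≤ m * (γ * q ^ k) := by
    intro i hi j hj
    rw [hH i hi j hj]
    refine abs_sum_range_le le_rfl (by positivity) fun l hl => ?_
    rw [abs_mul]
    exact mul_le_mul (hf.abs_directionGram_le i l) (hb l hl j hj) (abs_nonneg _) (by omega)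
  refine Runs.seq (Runs.sumLoop (i := 0) (j := 0) (fun l => τ 8 l l) hτ
    (by rw [hfrτ 0 (by decide)]; exact hin''.goods) hf.goods_le hf.goods_lt (by decide) (by decide)
    (by decide) (fun _ _ => ⟨rfl, rfl⟩) (fun n hn σ hσ hn' => ?_) fun n hn => ?_) ?_
  · simp [Expr.eval, hσ 8, hn']
  · exact (abs_sum_range_le hn (by positivity) fun l hl => hHb l hl l hl).trans_lt hstep
  rintro σ hσ hfrσ ⟨htr, -⟩
  have htr' : σ 9 0 0 = (G * faddeev G k).trace := by
    rw [htr, sum_range]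
    exact sum_congr rfl fun l _ => hH' l l
  have h8 : σ 8 = τ 8 := hfrσ 8 (by decide)
  have h7 : σ 7 = ρ 7 := by rw [hfrσ 7 (by decide), hfrτ 7 (by decide)]
  have h21 : σ 21 0 0 = k := by rw [hfrσ 21 (by decide), hfrτ 21 (by decide), hk']
  have h00 : σ 0 0 0 = m := by
    rw [hfrσ 0 (by decide), hfrτ 0 (by decide)]; exact hin''.goods
  refine Runs.cond hσ (fun hc => ?_) fun hc => ?_
  · have hc' : 0 < (G * faddeev G k).trace := by rw [← htr']; exact hc
    have hentry : ∀ i j : Fin m, faddeev G (k + 1) i j = σ 9 0 0 * (if (i : ℕ) = j then 1 else 0)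
        - ((k : ℤ) + 1) * σ 8 i j := by
      intro i j
      rw [faddeev, if_pos hc', Matrix.sub_apply, Matrix.smul_apply, Matrix.smul_apply,
        Matrix.one_apply, htr', h8, hH' i j]
      simp only [Fin.ext_iff, smul_eq_mul]
    refine (Runs.fill (a := 7) (fun i j => σ 9 0 0 * (if i = j then 1 else 0) - ((k : ℤ) + 1) * σ 8 i j) hσ
      h00 hf.goods_le hf.goods_lt (by decide) (by decide) (by decide)
      (by decide) (by decide) (by decide) (by decide) (by decide) ?_).mono ?_
    · intro i hi j hj υ hυ hfr3 hx hy
      have hev : (Expr.sub (.mul (var 9) (eqExpr 22 23))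
          (.mul (.add (var 21) (.const 1)) (.read 8 (var 22) (var 23)))).eval υ
          = σ 9 0 0 * (if i = j then 1 else 0) - ((k : ℤ) + 1) * σ 8 i j := by
        rw [Expr.eval, Expr.eval, eqExpr_eval hx hy]
        simp [Expr.eval, hx, hy, hfr3 9 (by decide) (by decide) (by decide),
          hfr3 8 (by decide) (by decide) (by decide), hfr3 21 (by decide) (by decide) (by decide),
          h21]
      refine Runs.write hυ ?_ ?_
      · rw [hev, ← hentry ⟨i, hi⟩ ⟨j, hj⟩]
        exact (hf.abs_faddeev_le (k + 1) hk _ _).trans_lt (hqβ k hk)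
      · rw [hev]
        simp only [Expr.eval, Int.toNat_zero, hx, hy, Int.toNat_natCast]
        refine ⟨by simp [Mem.set], fun i' j' h => ?_⟩
        simp only [Mem.set, true_and, if_neg h]
    · intro υ _ _ h i j
      rw [h i i.2 j j.2, hentry]
  · refine Runs.nop hσ fun i j => ?_
    have hc' : ¬ 0 < (G * faddeev G k).trace := by rw [← htr']; exact not_lt.2 hc
    rw [h7, hI, faddeev, if_neg hc']

end Phases

/-! ### Choosing a direction and moving along it -/

section Steps

open Finset

variable {N β m L : ℕ} {f₁ f₂ : ℕ → ℕ → ℤ} {γ q : ℤ} {X y : ℕ → ℤ} {D : ℤ} {μ : Mem}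

/-- If no diagonal entry is positive, column `0` is returned; it is still a direction, so the later
phases need no case distinction. -/
theorem Runs.pivotProg (hμ : Bounded β μ) (hin : HoldsInput m L f₁ f₂ μ)
    (hf : Fits N β m L f₁ f₂ γ q) (hm : 0 < m) :
    Runs N β pivotProg μ fun ν => ∃ p < m, ν 10 0 0 = (p : ℕ) ∧
      ((∃ j < m, 0 < μ 7 j j) → 0 < μ 7 p p) := by
  refine Runs.seq (R := fun ν => ν = μ.set 10 0 0 0) (Runs.write hμ (by simp [Expr.eval]) rfl) ?_
  rintro ν hν - rfl
  refine (Runs.forLoop (fun n ν => ∃ p < m, ν 10 0 0 = (p : ℕ) ∧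
      ((∃ j < n, 0 < μ 7 j j) → 0 < μ 7 p p)) hν hin.goods hf.goods_le hf.goods_lt (by decide)
      (by decide) (by decide) (fun n ν z h => ?_) ?_ ?_)
  · rwa [Mem.set_of_ne (by decide)]
  · exact ⟨0, hm, rfl, fun ⟨j, hj, _⟩ => absurd hj (Nat.not_lt_zero j)⟩
  intro n hn ρ hρ hx hfr ⟨p, hp, hp1, hp2⟩
  have h7 : ρ 7 = μ 7 := hfr 7 (by decide) (by decide)
  have hev : (Expr.read 7 (var 22) (var 22)).eval ρ = μ 7 n n := by simp [Expr.eval, hx, h7]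
  refine Runs.cond hρ (fun hc => Runs.write hρ ?_ ?_) fun hc => Runs.nop hρ ?_
  · simp only [Expr.eval, Int.toNat_zero, hx, Nat.abs_cast]
    exact lt_trans (by exact_mod_cast hn) hf.goods_lt
  · rw [hev] at hc
    exact ⟨n, hn, by simp [Expr.eval, Mem.set, hx], fun _ => hc⟩
  · rw [hev] at hc
    refine ⟨p, hp, hp1, fun ⟨j, hj, hj'⟩ => hp2 ⟨j, ?_, hj'⟩⟩
    rcases Nat.lt_succ_iff_lt_or_eq.1 hj with h | rfl
    · exact h
    · exact absurd hj' (not_lt.2 hc)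

/-- Choosing the sign is what replaces the equation for the first agent in dimension `0`: the
objective never decreases. -/
theorem Runs.signProg (hμ : Bounded β μ) (hin : HoldsInput m L f₁ f₂ μ)
    (hf : Fits N β m L f₁ f₂ γ q) (hm : 0 < m) {p : ℕ} (hp : μ 10 0 0 = p)
    (hb : ∀ i < m, |μ 7 i p| ≤ q ^ m) :
    Runs N β signProg μ fun ν => (ν 12 0 0 = 1 ∨ ν 12 0 0 = -1) ∧
      0 ≤ ∑ i ∈ range m, f₁ i 0 * (ν 12 0 0 * μ 7 i p) := by
  have hq := hf.one_le_growth hm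
  have hγ := hf.one_le
  have hβ : (1 : ℤ) < 2 ^ β := hγ.trans_lt hf.entry_lt
  refine Runs.seq (Runs.sumLoop (i := 0) (j := 0) (fun l => f₁ l 0 * μ 7 l p) hμ hin.goods
    hf.goods_le hf.goods_lt (by decide) (by decide) (by decide) (fun _ _ => ⟨rfl, rfl⟩)
    (fun n hn ρ hρ hn' => ?_) fun n hn => ?_) ?_
  · simp [Expr.eval, hρ 1, hρ 7, hρ 10, hn', hin.fst, hp]
  · refine (abs_sum_range_le hn (b := γ * q ^ m) (by positivity) fun l hl => ?_).trans_lt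
      (by rw [← mul_assoc]; exact hf.sum_lt)
    rw [abs_mul]
    exact mul_le_mul (hf.objective_le l) (hb l hl) (abs_nonneg _) (by omega)
  · rintro ν hν hfr ⟨h1, -⟩
    have hs : ∀ s : ℤ, ∑ i ∈ range m, f₁ i 0 * (s * μ 7 i p) = s * ν 11 0 0 := by
      intro s
      rw [h1, mul_sum]
      exact sum_congr rfl fun i _ => by ring
    simp only [hs]
    refine Runs.cond hν (fun hc => Runs.write hν (by simpa [Expr.eval] using hβ) ?_)
      fun hc => Runs.write hν (by simpa [Expr.eval] using hβ) ?_
    · simp only [Expr.eval, Int.toNat_zero] at hc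
      simpa [Expr.eval, Mem.set] using hc.le
    · simp only [Expr.eval, Int.toNat_zero] at hc
      simpa [Expr.eval, Mem.set] using hc

theorem Runs.moveProg (hμ : Bounded β μ) (hX : IsHalving m L f₁ f₂ X D) {i p : ℕ} {s : ℤ}
    (hi : i < m) (hx : μ 22 0 0 = i) (hXi : μ 4 i 0 = X i) (hD : μ 5 0 0 = D) (hp : μ 10 0 0 = p)
    (hs : μ 12 0 0 = s) (hy : s * μ 7 i p = y i) (hyβ : |y i| < 2 ^ β) :
    Runs N β moveProg μ fun ν => ν 16 0 0 = |y i| ∧ ν 17 0 0 = room X D y i ∧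
      ν 15 i 0 = y i ∧ ∀ j, j ≠ i → ν 15 j 0 = μ 15 j 0 := by
  have hDβ : D < 2 ^ β := hD ▸ (le_abs_self _).trans_lt (hμ 5 0 0)
  have hev : (Expr.mul (var 12) (.read 7 (var 22) (var 10))).eval μ = y i := by
    simp [Expr.eval, hx, hp, hs, hy]
  refine Runs.seq (R := fun ν => ν = μ.set 15 i 0 (y i)) (Runs.write hμ (by rwa [hev]) ?_) ?_
  · rw [hev]
    simp [Expr.eval, hx]
  rintro ν hν - rfl
  have hyv : (μ.set 15 i 0 (y i)) 15 i 0 = y i := by simp [Mem.set]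
  have hx' : (μ.set 15 i 0 (y i)) 22 0 0 = i := by rw [Mem.set_of_ne (by decide), hx]
  have hXi' : (μ.set 15 i 0 (y i)) 4 i 0 = X i := by rw [Mem.set_of_ne (by decide), hXi]
  have hD' : (μ.set 15 i 0 (y i)) 5 0 0 = D := by rw [Mem.set_of_ne (by decide), hD]
  have hne : ∀ j, j ≠ i → (μ.set 15 i 0 (y i)) 15 j 0 = μ 15 j 0 := fun j hj => by
    simp [Mem.set, hj]
  generalize μ.set 15 i 0 (y i) = τ at *
  have hroom : |room X D y i| < 2 ^ β := by
    rw [abs_of_nonneg (hX.room_nonneg hi)]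
    exact (hX.room_le hi).trans_lt hDβ
  have key : ∀ e e' : Expr, e.eval τ = |y i| →
      (∀ z, e'.eval (τ.set 16 0 0 z) = room X D y i) →
      Runs N β (.seq (assign 16 e) (assign 17 e')) τ fun ν => ν 16 0 0 = |y i| ∧
        ν 17 0 0 = room X D y i ∧ ν 15 i 0 = y i ∧ ∀ j, j ≠ i → ν 15 j 0 = μ 15 j 0 := by
    intro e e' he he'
    refine Runs.seq (R := fun ν => ν = τ.set 16 0 0 |y i|)
      (Runs.write hν (by rwa [he, abs_abs]) (by rw [he]; rfl)) ?_
    rintro ν hν' - rfl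
    refine Runs.write hν' (by rwa [he']) ?_
    rw [he']
    simp only [Expr.eval, Int.toNat_zero]
    rw [Mem.set_of_ne (by decide : 16 ≠ 17), Mem.set_of_ne (by decide : 15 ≠ 17),
      Mem.set_of_ne (by decide : 15 ≠ 16)]
    exact ⟨by simp [Mem.set], by simp [Mem.set], hyv, hne⟩
  have hcond : (Expr.read 15 (var 22) (.const 0)).eval τ = y i := by simp [Expr.eval, hx', hyv]
  refine Runs.cond hν (fun hc => key _ _ ?_ fun z => ?_) fun hc => key _ _ ?_ fun z => ?_ <;>
    rw [hcond] at hc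
  · rw [hcond, abs_of_pos hc]
  · simp only [Expr.eval, Int.toNat_zero, Mem.set_of_ne (by decide : 22 ≠ 16),
      Mem.set_of_ne (by decide : 4 ≠ 16), Mem.set_of_ne (by decide : 5 ≠ 16), hx', hD',
      Int.toNat_natCast, hXi', room, if_pos hc]
  · rw [Expr.eval, hcond, abs_of_nonpos hc]
    simp [Expr.eval]
  · simp only [Expr.eval, Int.toNat_zero, Mem.set_of_ne (by decide : 22 ≠ 16),
      Mem.set_of_ne (by decide : 4 ≠ 16), hx', Int.toNat_natCast, hXi', room, if_neg hc.not_gt]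

theorem Runs.ratioProg (hμ : Bounded β μ) (hin : HoldsDivision m L f₁ f₂ X D μ)
    (hf : Fits N β m L f₁ f₂ γ q) (hX : IsHalving m L f₁ f₂ X D) {p : ℕ} {s : ℤ}
    (hp : μ 10 0 0 = p) (hs : μ 12 0 0 = s) (hy : ∀ i < m, s * μ 7 i p = y i)
    (hyβ : ∀ i < m, |y i| < 2 ^ β) :
    Runs N β ratioProg μ fun ν => (∀ i < m, ν 15 i 0 = y i) ∧
      IsStep X D y m (ν 13 0 0) (ν 14 0 0) := by
  have hβ : (1 : ℤ) < 2 ^ β := hf.one_le.trans_lt hf.entry_lt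
  refine Runs.seq (R := fun ν => ν = μ.set 13 0 0 1)
    (Runs.write hμ (by simpa [Expr.eval] using hβ) rfl) ?_
  rintro ν hν - rfl
  refine Runs.seq (R := fun ν => ν = (μ.set 13 0 0 1).set 14 0 0 0)
    (Runs.write hν (by simp [Expr.eval]) rfl) ?_
  rintro ν hν - rfl
  refine (Runs.forLoop (fun n ν => (∀ i < n, ν 15 i 0 = y i) ∧
      IsStep X D y n (ν 13 0 0) (ν 14 0 0)) hν hin.goods hf.goods_le hf.goods_lt (by decide)
      (by decide) (by decide) (fun n ν z h => ?_) ?_ ?_)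
  · rwa [Mem.set_of_ne (by decide), Mem.set_of_ne (by decide), Mem.set_of_ne (by decide)]
  · exact ⟨fun i hi => absurd hi (Nat.not_lt_zero i), IsStep.zero⟩
  rintro n hn ρ hρ hx hfr ⟨h15, hst⟩
  have hfr' : ∀ b, b ≠ 13 → b ≠ 14 → b ≠ 15 → b ≠ 16 → b ≠ 17 → b ≠ 22 → ρ b = μ b := by
    intro b h13 h14 _ _ _ h22
    rw [hfr b h22 (by simp [MDFA.moveProg, Program.writes, *]), Mem.set_of_ne h14,
      Mem.set_of_ne h13]
  have hin' := hin.of_eq (ν := ρ) (hfr' 0 (by decide) (by decide) (by decide) (by decide)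
    (by decide) (by decide)) (hfr' 1 (by decide) (by decide) (by decide) (by decide)
    (by decide) (by decide)) (hfr' 2 (by decide) (by decide) (by decide) (by decide)
    (by decide) (by decide)) (hfr' 4 (by decide) (by decide) (by decide) (by decide)
    (by decide) (by decide)) (hfr' 5 (by decide) (by decide) (by decide) (by decide)
    (by decide) (by decide)) (hfr' 6 (by decide) (by decide) (by decide) (by decide)
    (by decide) (by decide))
  have h7 := hfr' 7 (by decide) (by decide) (by decide) (by decide) (by decide) (by decide)
  have h10 := hfr' 10 (by decide) (by decide) (by decide) (by decide) (by decide) (by decide)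
  have h12 := hfr' 12 (by decide) (by decide) (by decide) (by decide) (by decide) (by decide)
  refine Runs.seq (Runs.moveProg (y := y) hρ hX hn hx (hin'.share n hn) hin'.denom
    (by rw [h10, hp]) (by rw [h12, hs]) (by rw [h7, hy n hn]) (hyβ n hn)) ?_
  rintro τ hτ hfrτ ⟨h16, h17, hyn, hyj⟩
  have h13 : τ 13 = ρ 13 := hfrτ 13 (by decide)
  have h14 : τ 14 = ρ 14 := hfrτ 14 (by decide)
  have h15' : ∀ i < n + 1, τ 15 i 0 = y i := by
    intro i hi
    rcases Nat.lt_succ_iff_lt_or_eq.1 hi with h | rfl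
    · rw [hyj i (by omega), h15 i h]
    · exact hyn
  have hcond : (Expr.sub (.mul (var 13) (var 16)) (.mul (var 14) (var 17))).eval τ
      = ρ 13 0 0 * |y n| - ρ 14 0 0 * room X D y n := by
    simp [Expr.eval, h13, h14, h16, h17]
  refine Runs.cond hτ (fun hc => ?_) fun hc => Runs.nop hτ ?_
  · rw [hcond, sub_pos] at hc
    have hres := hst.succ_of_lt (fun i hi => hX.room_nonneg (by omega)) hc
    refine Runs.seq (R := fun ν => ν = τ.set 13 0 0 (room X D y n))
      (Runs.write hτ ?_ ?_) ?_
    · simpa only [Expr.eval, Int.toNat_zero] using hτ 17 0 0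
    · simp only [Expr.eval, Int.toNat_zero, h17]
    rintro ν hν - rfl
    refine Runs.write hν ?_ ?_
    · simpa only [Expr.eval, Int.toNat_zero] using hν 16 0 0
    · simp only [Expr.eval, Int.toNat_zero]
      rw [Mem.set_of_ne (by decide : 15 ≠ 14), Mem.set_of_ne (by decide : 15 ≠ 13),
        Mem.set_of_ne (by decide : 13 ≠ 14), Mem.set_of_ne (by decide : 16 ≠ 13), h16]
      refine ⟨h15', ?_⟩
      simpa [Mem.set] using hres
  · rw [hcond, sub_nonpos] at hc
    rw [h13, h14]
    exact ⟨h15', hst.succ_of_le hc⟩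

theorem Runs.shiftProg (hμ : Bounded β μ) (hin : HoldsDivision m L f₁ f₂ X D μ)
    (hf : Fits N β m L f₁ f₂ γ q) (hX : IsHalving m L f₁ f₂ X D) {num den : ℤ}
    (hnum : μ 13 0 0 = num) (hden : μ 14 0 0 = den)
    (hy : ∀ i < m, μ 15 i 0 = y i) (hst : IsStep X D y m num den) (hlt : D * den < 2 ^ β) :
    Runs N β shiftProg μ fun ν =>
      (0 < den → HoldsDivision m L f₁ f₂ (fun i => X i * den + num * y i) (D * den) ν) ∧
      (den ≤ 0 → HoldsDivision m L f₁ f₂ X D ν) := by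
  have hev : (var 14).eval μ = den := by simp [Expr.eval, hden]
  refine Runs.cond hμ (fun hc => ?_) fun hc => Runs.nop hμ ?_ <;> rw [hev] at hc
  -- The update is in place, so the invariant must also say that the items not yet visited hold
  -- their old shares. The old denominator is overwritten only afterwards.
  · refine Runs.seq (Runs.forLoop (fun n ν => (∀ i < n, ν 4 i 0 = X i * den + num * y i) ∧
      ∀ i < m, n ≤ i → ν 4 i 0 = X i) hμ hin.goods hf.goods_le hf.goods_lt (by decide)
      (by decide) (by decide) (fun n ν z h => ?_) ?_ ?_) ?_
    · rwa [Mem.set_of_ne (by decide)]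
    · exact ⟨fun i hi => absurd hi (Nat.not_lt_zero i), fun i hi _ => hin.share i hi⟩
    · rintro n hn ν hν hx hfr ⟨h1, h2⟩
      have hev : (Expr.add (.mul (.read 4 (var 22) (.const 0)) (var 14))
          (.mul (var 13) (.read 15 (var 22) (.const 0)))).eval ν = X n * den + num * y n := by
        simp only [Expr.eval, Int.toNat_zero, hx, Int.toNat_natCast, h2 n hn le_rfl,
          hfr 14 (by decide) (by decide), hfr 13 (by decide) (by decide),
          hfr 15 (by decide) (by decide), hden, hnum, hy n hn]
      refine Runs.write hν ?_ ?_
      · rw [hev, abs_of_nonneg (hst.shift_nonneg hX hn)]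
        exact (hst.shift_le hX hn).trans_lt hlt
      · rw [hev]
        simp only [Expr.eval, Int.toNat_zero, hx, Int.toNat_natCast]
        refine ⟨fun i hi => ?_, fun i him hi => ?_⟩
        · rcases Nat.lt_succ_iff_lt_or_eq.1 hi with h | rfl
          · simp [Mem.set, h.ne, h1 i h]
          · simp [Mem.set]
        · have : i ≠ n := by omega
          simp [Mem.set, this, h2 i him (by omega)]
    · rintro ν hν hfr ⟨h1, -⟩
      have hev : (Expr.mul (var 5) (var 14)).eval ν = D * den := by
        simp [Expr.eval, hfr 5 (by decide), hfr 14 (by decide), hin.denom, hden]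
      refine Runs.write hν ?_ ?_
      · rw [hev, abs_of_nonneg (mul_nonneg hX.pos.le hc.le)]
        exact hlt
      · rw [hev]
        simp only [Expr.eval, Int.toNat_zero]
        refine ⟨fun _ => ?_, fun h => absurd hc (not_lt.2 h)⟩
        have h0 := hin.toHoldsInput.of_eq (ν := ν) (hfr 0 (by decide)) (hfr 1 (by decide))
          (hfr 2 (by decide))
        refine { h0.of_eq (Mem.set_of_ne (by decide) _ _ _) (Mem.set_of_ne (by decide) _ _ _)
          (Mem.set_of_ne (by decide) _ _ _) with
          share := ?_, denom := by simp [Mem.set], gram := ?_ }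
        · rw [Mem.set_of_ne (by decide)]
          exact h1
        · rw [Mem.set_of_ne (by decide), hfr 6 (by decide)]
          exact hin.gram
  · exact ⟨fun h => absurd h (not_lt.2 hc), fun _ => hin⟩

/-- The invariant of the main loop. -/
def Progress (m L : ℕ) (f₁ f₂ : ℕ → ℕ → ℤ) (q : ℤ) (t : ℕ) (μ : Mem) : Prop :=
  ∃ X D, HoldsDivision m L f₁ f₂ X D μ ∧ IsHalving m L f₁ f₂ X D ∧ D ≤ 2 * (q ^ m) ^ t ∧
    (t ≤ numWhole m X D ∨ IsVertex m L f₁ f₂ X D)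

theorem IsDirection.const_mul {y : ℕ → ℤ} (h : IsDirection m L f₁ f₂ X D y) (s : ℤ) :
    IsDirection m L f₁ f₂ X D fun i => s * y i := by
  have hs : ∀ f : ℕ → ℤ, ∑ i ∈ range m, f i * (s * y i) = s * ∑ i ∈ range m, f i * y i := by
    intro f
    rw [mul_sum]
    exact sum_congr rfl fun i _ => by ring
  refine ⟨fun k hk => ?_, fun k hk => ?_, fun i hi hsp => by rw [h.zero i hi hsp, mul_zero]⟩
  · have := h.eq₁ k hk
    simp only [Int.cast_id] at this ⊢
    rw [hs fun i => f₁ i (k + 1), this, mul_zero]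
  · have := h.eq₂ k hk
    simp only [Int.cast_id] at this ⊢
    rw [hs fun i => f₂ i k, this, mul_zero]

theorem IsStep.den_le (h : IsStep X D y m num den) {b : ℤ} (hb : 0 ≤ b)
    (hy : ∀ i < m, |y i| ≤ b) : den ≤ b := by
  rcases h.attained with ⟨-, h2⟩ | ⟨q, hq, -, -, h2⟩
  · rwa [h2]
  · rw [h2]
    exact hy q hq

/-- A positive `den` makes one more item whole, while `den = 0` certifies a vertex. Each round
multiplies the denominator by at most `q ^ m`, the bound for the entries of the direction. -/
theorem Runs.wholeStep (hμ : Bounded β μ) (hf : Fits N β m L f₁ f₂ γ q) {t : ℕ} (ht : t < m)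
    (hI : Progress m L f₁ f₂ q t μ) : Runs N β wholeStep μ (Progress m L f₁ f₂ q (t + 1)) := by
  obtain ⟨X, D, hin, hX, hD, hprog⟩ := hI
  have hm : 0 < m := by omega
  have hq := hf.one_le_growth hm
  have hQ : 1 ≤ q ^ m := one_le_pow₀ hq
  have hQt : 1 ≤ (q ^ m) ^ t := one_le_pow₀ hQ
  have hD' : D ≤ 2 * (q ^ m) ^ (t + 1) := by
    rw [pow_succ]
    nlinarith
  have hQβ : q ^ m < 2 ^ β := by
    have := hf.denom_lt 1 hm
    rw [pow_one] at this
    linarith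
  refine Runs.seq (Runs.faddeevProg hμ hin hf hm) ?_
  intro ν₁ b₁ fr₁ h7
  have hin₁ := hin.of_eq (ν := ν₁) (fr₁ 0 (by decide)) (fr₁ 1 (by decide)) (fr₁ 2 (by decide))
    (fr₁ 4 (by decide)) (fr₁ 5 (by decide)) (fr₁ 6 (by decide))
  obtain ⟨hdir, hvert⟩ := faddeev_directionGram_spec m L f₁ f₂ X D (ν₁ 7) h7
  have hNb : ∀ i < m, ∀ j < m, |ν₁ 7 i j| ≤ q ^ m := fun i hi j hj => by
    rw [h7 ⟨i, hi⟩ ⟨j, hj⟩]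
    exact hf.abs_faddeev_le m le_rfl _ _
  refine Runs.seq (Runs.pivotProg b₁ hin₁.toHoldsInput hf hm) ?_
  rintro ν₂ b₂ fr₂ ⟨p, hp, hp10, hpos⟩
  have hin₂ := hin₁.of_eq (ν := ν₂) (fr₂ 0 (by decide)) (fr₂ 1 (by decide)) (fr₂ 2 (by decide))
    (fr₂ 4 (by decide)) (fr₂ 5 (by decide)) (fr₂ 6 (by decide))
  have h7₂ : ν₂ 7 = ν₁ 7 := fr₂ 7 (by decide)
  refine Runs.seq (Runs.signProg b₂ hin₂.toHoldsInput hf hm hp10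
    fun i hi => by rw [h7₂]; exact hNb i hi p hp) ?_
  rintro ν₃ b₃ fr₃ ⟨hs, hobj⟩
  have hin₃ := hin₂.of_eq (ν := ν₃) (fr₃ 0 (by decide)) (fr₃ 1 (by decide)) (fr₃ 2 (by decide))
    (fr₃ 4 (by decide)) (fr₃ 5 (by decide)) (fr₃ 6 (by decide))
  have h7₃ : ν₃ 7 = ν₁ 7 := by rw [fr₃ 7 (by decide), h7₂]
  rw [h7₂] at hobj
  set s := ν₃ 12 0 0 with hsdef
  have hyb : ∀ i < m, |s * ν₁ 7 i p| ≤ q ^ m := fun i hi => by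
    rw [abs_mul]
    rcases hs with hs | hs <;> simpa [hs] using hNb i hi p hp
  refine Runs.seq (Runs.ratioProg (y := fun i => s * ν₁ 7 i p) b₃ hin₃ hf hX
    (by rw [fr₃ 10 (by decide), hp10]) hsdef.symm (fun i _ => by rw [h7₃])
    fun i hi => (hyb i hi).trans_lt hQβ) ?_
  rintro ν₄ b₄ fr₄ ⟨h15, hst⟩
  have hin₄ := hin₃.of_eq (ν := ν₄) (fr₄ 0 (by decide)) (fr₄ 1 (by decide)) (fr₄ 2 (by decide))
    (fr₄ 4 (by decide)) (fr₄ 5 (by decide)) (fr₄ 6 (by decide))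
  have hdenle : ν₄ 14 0 0 ≤ q ^ m := hst.den_le (by omega) hyb
  have hDden : D * ν₄ 14 0 0 ≤ 2 * (q ^ m) ^ (t + 1) := by
    rw [pow_succ, ← mul_assoc]
    exact mul_le_mul hD hdenle hst.den_nonneg (by positivity)
  refine (Runs.shiftProg b₄ hin₄ hf hX rfl rfl h15 hst
    (hDden.trans_lt (hf.denom_lt _ ht))).mono ?_
  rintro ν₅ - - ⟨h1, h2⟩
  have hdir' := (hdir p hp).const_mul s
  rcases lt_or_ge 0 (ν₄ 14 0 0) with hden | hden
  · refine ⟨_, _, h1 hden, hX.shift hdir' hobj hst hden, hDden, ?_⟩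
    have hnum := hX.numWhole_shift hdir' hobj hst hden
    rcases hprog with hprog | hprog
    · left
      omega
    -- At a vertex the chosen column is zero, so no item can have attained a step with positive
    -- `den`.
    · exfalso
      have hz : ∀ i < m, s * ν₁ 7 i p = 0 := by
        intro i hi
        have := hprog (fun i => ((s * ν₁ 7 i p : ℤ) : ℝ)) ⟨fun k hk => ?_, fun k hk => ?_,
          fun i hi hsp => ?_⟩ i hi
        · exact_mod_cast this
        · exact_mod_cast hdir'.eq₁ k hk
        · exact_mod_cast hdir'.eq₂ k hk
        · exact_mod_cast hdir'.zero i hi hsp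
      rcases hst.attained with ⟨-, h⟩ | ⟨r, hr, -, -, h⟩
      · omega
      · rw [hz r hr] at h
        simp [h] at hden
  -- If this were not a vertex, the pivot column would have a positive diagonal entry, hence be
  -- nonzero and bound the step.
  · refine ⟨_, _, h2 hden, hX, hD', Or.inr ?_⟩
    by_contra hv
    have hpp := hpos (hvert hv)
    refine absurd (hst.den_pos hp ?_) (not_lt.2 hden)
    rcases hs with hs | hs <;> simp [hs, hpp.ne']

end Steps

/-! ### The whole program and its digit bound -/

section Main

open Finset

variable {N β m L : ℕ} {f₁ f₂ : ℕ → ℕ → ℤ} {γ q : ℤ} {X : ℕ → ℤ} {D : ℤ} {μ : Mem}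

theorem Runs.initProg (hμ : Bounded β μ) (hin : HoldsInput m L f₁ f₂ μ)
    (hf : Fits N β m L f₁ f₂ γ q) (hβ : (2 : ℤ) < 2 ^ β) :
    Runs N β initProg μ fun ν => ν 5 0 0 = 2 ∧ ∀ i < m, ν 4 i 0 = 1 := by
  refine Runs.seq (R := fun ν => ν = μ.set 5 0 0 2)
    (Runs.write hμ (by simpa [Expr.eval] using hβ) rfl) ?_
  rintro ν hν - rfl
  refine (Runs.forLoop (K := m) (c := 0) (fun n ν => ∀ i < n, ν 4 i 0 = 1) hν hin.goods hf.goods_le hf.goods_lt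
    (by decide) (by decide) (by decide) (fun n ν z h => ?_)
    (fun i hi => absurd hi (Nat.not_lt_zero i)) ?_).mono ?_
  · rwa [Mem.set_of_ne (by decide)]
  · rintro n hn ρ hρ hx hfr h
    refine Runs.write hρ ?_ fun i hi => ?_
    · simp only [Expr.eval, abs_one]
      linarith
    · simp only [Expr.eval, Int.toNat_zero, hx, Int.toNat_natCast]
      rcases Nat.lt_succ_iff_lt_or_eq.1 hi with h' | rfl
      · simp [Mem.set, h'.ne, h i h']
      · simp [Mem.set]
  · intro ρ _ hfr h
    rw [hfr 5 (by decide)]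
    exact ⟨by simp [Mem.set], h⟩

theorem Runs.roundProg (hμ : Bounded β μ) (hin : HoldsDivision m L f₁ f₂ X D μ)
    (hf : Fits N β m L f₁ f₂ γ q) :
    Runs N β roundProg μ fun ν => ∀ i < m, ν 3 i 0 = if 0 < 2 * X i - D then 0 else 1 := by
  have hβ : (1 : ℤ) < 2 ^ β := hf.one_le.trans_lt hf.entry_lt
  refine Runs.forLoop (fun n ν => ∀ i < n, ν 3 i 0 = if 0 < 2 * X i - D then 0 else 1) hμ
    hin.goods hf.goods_le hf.goods_lt (by decide) (by decide) (by decide) (fun n ν z h => ?_)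
    (fun i hi => absurd hi (Nat.not_lt_zero i)) ?_
  · rwa [Mem.set_of_ne (by decide)]
  rintro n hn ν hν hx hfr h
  have hev : (Expr.sub (.mul (.const 2) (.read 4 (var 22) (.const 0))) (var 5)).eval ν
      = 2 * X n - D := by
    simp [Expr.eval, hx, hfr 4 (by decide) (by decide), hfr 5 (by decide) (by decide),
      hin.share n hn, hin.denom]
  refine Runs.cond hν (fun hc => Runs.write hν (by simp [Expr.eval]) fun i hi => ?_)
    fun hc => Runs.write hν (by simpa [Expr.eval] using hβ) fun i hi => ?_
  all_goals
    rw [hev] at hc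
    simp only [Expr.eval, Int.toNat_zero, hx, Int.toNat_natCast]
    rcases Nat.lt_succ_iff_lt_or_eq.1 hi with h' | rfl
    · simp [Mem.set, h'.ne, h i h']
    · first
        | (simp only [Mem.set, and_self, if_true, if_pos hc]; done)
        | simp only [Mem.set, and_self, if_true, if_neg (not_lt.2 hc)]

theorem isHalving_one_two (m L : ℕ) (f₁ f₂ : ℕ → ℕ → ℤ) :
    IsHalving m L f₁ f₂ (fun _ => 1) 2 :=
  ⟨by norm_num, fun _ _ => by norm_num, fun _ _ => by norm_num, by simp, fun _ _ => by simp,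
    fun _ _ => by simp⟩

theorem Runs.halvingProg (hμ : Bounded β μ) (hin : HoldsInput m L f₁ f₂ μ)
    (hf : Fits N β m L f₁ f₂ γ q) (hβ : (2 : ℤ) < 2 ^ β) :
    Runs N β halvingProg μ fun ν => ∃ X D, IsHalving m L f₁ f₂ X D ∧
      (m ≤ numWhole m X D ∨ IsVertex m L f₁ f₂ X D) ∧
      ∀ i < m, ν 3 i 0 = if 0 < 2 * X i - D then 0 else 1 := by
  refine Runs.seq (Runs.initProg hμ hin hf hβ) ?_
  rintro ν₁ b₁ fr₁ ⟨h5, h4⟩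
  have hin₁ := hin.of_eq (ν := ν₁) (fr₁ 0 (by decide)) (fr₁ 1 (by decide)) (fr₁ 2 (by decide))
  refine Runs.seq (Runs.gramProg b₁ hin₁ hf) ?_
  intro ν₂ b₂ fr₂ h6
  have hin₂ := hin₁.of_eq (ν := ν₂) (fr₂ 0 (by decide)) (fr₂ 1 (by decide)) (fr₂ 2 (by decide))
  have hdiv : HoldsDivision m L f₁ f₂ (fun _ => 1) 2 ν₂ :=
    { hin₂ with
      share := by rw [fr₂ 4 (by decide)]; exact h4
      denom := by rw [fr₂ 5 (by decide)]; exact h5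
      gram := h6 }
  refine Runs.seq (Runs.forLoop (K := m) (Progress m L f₁ f₂ q) b₂ hin₂.goods hf.goods_le
    hf.goods_lt (by decide) (by decide) (by decide) ?_ ?_ ?_) ?_
  · rintro t ν z ⟨X, D, h, h'⟩
    exact ⟨X, D, h.of_eq (Mem.set_of_ne (by decide) _ _ _) (Mem.set_of_ne (by decide) _ _ _)
      (Mem.set_of_ne (by decide) _ _ _) (Mem.set_of_ne (by decide) _ _ _)
      (Mem.set_of_ne (by decide) _ _ _) (Mem.set_of_ne (by decide) _ _ _), h'⟩
  · exact ⟨_, _, hdiv, isHalving_one_two m L f₁ f₂, by simp, Or.inl (Nat.zero_le _)⟩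
  · intro t ht ν hν _ _ hI
    exact Runs.wholeStep hν hf ht hI
  · rintro ν b - ⟨X, D, h, hX, -, hw⟩
    exact (Runs.roundProg b h hf).mono fun ρ _ _ hρ => ⟨X, D, hX, hw, hρ⟩

theorem Instance.value_lt (I : Instance 2) (i : Fin 2) (g : Fin I.goods) (k : Fin I.dims) :
    I.value i g k < 2 ^ I.size := by
  have h1 : bitLen (I.value i g k) ≤ ∑ i, ∑ g, ∑ k, bitLen (I.value i g k) :=
    (single_le_sum (f := fun k => bitLen (I.value i g k)) (fun _ _ => Nat.zero_le _)
      (mem_univ k)).trans <|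
    (single_le_sum (f := fun g => ∑ k, bitLen (I.value i g k)) (fun _ _ => Nat.zero_le _)
      (mem_univ g)).trans <|
    single_le_sum (f := fun i => ∑ g, ∑ k, bitLen (I.value i g k)) (fun _ _ => Nat.zero_le _)
      (mem_univ i)
  have h2 := natAbs_lt_bitLen (I.value i g k)
  rw [Int.natAbs_natCast] at h2
  refine h2.trans_le (Nat.pow_le_pow_right (by norm_num) ?_)
  unfold Instance.size
  omega

theorem Instance.abs_toMem_lt (I : Instance 2) (a i j : ℕ) : |I.toMem a i j| < 2 ^ I.size := by
  have hn : ∀ n ≤ I.size, |(n : ℤ)| < 2 ^ I.size := fun n hn => by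
    rw [Nat.abs_cast]
    exact_mod_cast hn.trans_lt Nat.lt_two_pow_self
  unfold Instance.toMem
  split
  · exact hn _ (by unfold Instance.size; omega)
  · exact hn _ (by unfold Instance.size; omega)
  · split_ifs with h
    · rw [Nat.abs_cast]
      exact_mod_cast I.value_lt _ _ _
    · simp
  · split_ifs with h
    · rw [Nat.abs_cast]
      exact_mod_cast I.value_lt _ _ _
    · simp
  · simp

/-- The number of binary digits that suffices for inputs of size `S`. -/
def digitBound (S : ℕ) : ℕ := (5 * S + 2) * (S * S + S) + (4 * S + 2)

/-- An entry of `halvingGram` has `L` summands of size at most `2 * 4 ^ S`; taking `L + 1` in `γ`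
makes the bound strict and leaves room for the diagonal unit. Then `γ ≤ 2 ^ (3 * S + 1)` and `q ≤ 2
^ (5 * S + 2)`. The exponent `m * t ≤ S * S` of the denominators dominates `digitBound`. -/
theorem Instance.fits (I : Instance 2) :
    Fits I.size (digitBound I.size) I.goods I.dims (I.toMem 1) (I.toMem 2)
      (2 * (I.dims + 1) * 4 ^ I.size)
      (2 * I.goods ^ 2 * (2 * (I.dims + 1) * 4 ^ I.size)) := by
  have hm : I.goods ≤ I.size := by unfold Instance.size; omega
  have hL : I.dims + 1 ≤ I.size := by unfold Instance.size; omega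
  have hab := I.abs_toMem_lt
  generalize I.size = S at *
  generalize I.goods = m at *
  generalize I.dims = L at *
  have hS : (S : ℤ) < 2 ^ S := by exact_mod_cast Nat.lt_two_pow_self
  have h4 : (4 : ℤ) ^ S = 2 ^ S * 2 ^ S := by rw [← mul_pow]; norm_num
  have hm' : (m : ℤ) ≤ 2 ^ S := by zify at hm; linarith
  have hL' : (L : ℤ) + 1 ≤ 2 ^ S := by zify at hL; linarith
  have hone : (1 : ℤ) ≤ 2 ^ S := one_le_pow₀ (by norm_num)
  have hlt : ∀ {a b : ℕ}, a < b → (2 : ℤ) ^ a < 2 ^ b := fun h =>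
    pow_lt_pow_right₀ (by norm_num) h
  have hβ : 3 * S + 1 < digitBound S := by unfold digitBound; omega
  set γ : ℤ := 2 * (L + 1) * 4 ^ S with hγ
  have hγ1 : 2 * 2 ^ S ≤ γ := by
    rw [hγ, h4]
    nlinarith [mul_le_mul hone hone (by norm_num) (by positivity),
      mul_nonneg (Int.natCast_nonneg L) (mul_nonneg (by positivity : (0 : ℤ) ≤ 2 ^ S)
        (by positivity : (0 : ℤ) ≤ 2 ^ S))]
  have hγ2 : γ ≤ 2 ^ (3 * S + 1) := by
    calc γ ≤ 2 * 2 ^ S * 4 ^ S := by rw [hγ]; gcongr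
      _ = 2 ^ (3 * S + 1) := by rw [h4]; ring
  have hq : 2 * (m : ℤ) ^ 2 * γ ≤ 2 ^ (5 * S + 2) := by
    calc 2 * (m : ℤ) ^ 2 * γ ≤ 2 * (2 ^ S) ^ 2 * 2 ^ (3 * S + 1) := by gcongr
      _ = _ := by ring
  have hγ0 : 0 ≤ γ := by linarith
  refine ⟨hm, ?_, by omega, ?_, fun i => ?_, by linarith, fun i j n hn => ?_, rfl,
    hγ2.trans_lt (hlt hβ), fun t ht => ?_, ?_⟩
  · exact hm'.trans_lt (hlt (by omega))
  · exact lt_of_lt_of_le (by linarith) (pow_le_pow_right₀ (by norm_num) (by omega : S ≤ _))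
  · have := hab 1 i 0
    linarith
  · have hprod : ∀ a b c a' b' c', |I.toMem a b c * I.toMem a' b' c'| ≤ 4 ^ S := by
      intro a b c a' b' c'
      rw [abs_mul, h4]
      exact mul_le_mul (hab a b c).le (hab a' b' c').le (abs_nonneg _) (by positivity)
    rw [halvingGram]
    have h1 := abs_sum_range_le (m := L) hn (b := 2 * 4 ^ S) (by positivity)
      (f := fun k => I.toMem 1 i (k + 1) * I.toMem 1 j (k + 1) + I.toMem 2 i k * I.toMem 2 j k)
      fun k _ => by
        have h2 := hprod 1 i (k + 1) 1 j (k + 1)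
        have h3 := hprod 2 i k 2 j k
        exact (abs_add_le _ _).trans (by linarith)
    refine h1.trans_lt ?_
    have : (0 : ℤ) < 4 ^ S := by positivity
    rw [hγ]
    linarith
  · calc 2 * ((2 * (m : ℤ) ^ 2 * γ) ^ m) ^ t ≤ 2 * ((2 ^ (5 * S + 2)) ^ m) ^ t := by gcongr
      _ = 2 ^ ((5 * S + 2) * (m * t) + 1) := by
        rw [← pow_mul, ← pow_mul]; ring
      _ < 2 ^ digitBound S := by
        apply hlt
        have : (5 * S + 2) * (m * t) ≤ (5 * S + 2) * (S * S) :=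
          Nat.mul_le_mul_left _ (Nat.mul_le_mul hm (ht.trans hm))
        rw [digitBound, mul_add]
        omega
  · calc m * γ * (2 * (m : ℤ) ^ 2 * γ) ^ m
        ≤ 2 ^ S * 2 ^ (3 * S + 1) * (2 ^ (5 * S + 2)) ^ m := by gcongr
      _ = 2 ^ ((5 * S + 2) * m + (4 * S + 1)) := by
        rw [← pow_mul]; ring
      _ < 2 ^ digitBound S := by
        apply hlt
        have : (5 * S + 2) * m ≤ (5 * S + 2) * S := Nat.mul_le_mul_left _ hm
        rw [digitBound, mul_add]
        omega

/-- A polynomial bound for the running time of `halvingProg`. -/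
noncomputable def halvingTime : Polynomial ℕ :=
  halvingProg.timePoly *
    ((5 * .X + 2) * (.X * .X + .X) + (4 * .X + 2) + 1) ^ 2

theorem halvingProg_spec (I : Instance 2) : ∃ (ν : Mem) (t : ℕ), Exec halvingProg I.toMem ν t ∧
    t ≤ halvingTime.eval I.size ∧ ∃ A : Allocation I, A.IsWrittenIn ν ∧
      ∀ c : ℕ, 2 * (I.dims : ℤ) - 1 ≤ c → A.StrongSEF c := by
  have hS : I.size ≤ digitBound I.size := by unfold digitBound; omega
  have hbdd : Bounded (digitBound I.size) I.toMem := fun a i j =>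
    (I.abs_toMem_lt a i j).trans_le (pow_le_pow_right₀ (by norm_num) hS)
  have hsize : 2 ≤ I.size := by unfold Instance.size; omega
  obtain ⟨ν, t, h1, h2, -, X, D, hX, hw, hν⟩ := Runs.halvingProg hbdd
    (⟨rfl, rfl, rfl, rfl⟩ : HoldsInput I.goods I.dims (I.toMem 1) (I.toMem 2) I.toMem) I.fits
    (lt_self_pow₀ (by norm_num) (by omega))
  refine ⟨ν, t, h1, ?_, roundedAllocation I X D, ?_, fun c hc => ?_⟩
  · simpa [halvingTime, digitBound] using h2
  · intro g i
    rw [hν g g.2]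
    obtain rfl | rfl : i = 0 ∨ i = 1 := by omega
    all_goals
      simp only [roundedAllocation, mem_filter, mem_univ, true_and]
      split_ifs with h <;> simpa using h
  -- The first agent's equation number `L` is vacuous because cells outside the input hold `0`.
  · refine roundedAllocation_strongSEF I hX (card_split_le_of_numWhole hw fun i _ => ?_) hc
    simp [Instance.toMem_one]

end Main

end MDFA

theorem mainTheorem2 :
    (∀ (I : MDFA.Instance 2) (c : ℕ), 2 * (I.dims : ℤ) - 1 ≤ c →
      ∃ A : MDFA.Allocation I, A.StrongSEF c) ∧
    MDFA.SolvableInPolyTime (fun I : MDFA.Instance 2 => I.size) (fun I => I.toMem)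
      (fun I ν => ∃ A : MDFA.Allocation I, A.IsWrittenIn ν ∧
        ∀ c : ℕ, 2 * (I.dims : ℤ) - 1 ≤ c → A.StrongSEF c) := by
  refine ⟨fun I c hc => ?_, MDFA.halvingProg, MDFA.halvingTime, MDFA.halvingProg_spec⟩
  -- Existence is read off from the output of the program.
  obtain ⟨-, -, -, -, A, -, hA⟩ := MDFA.halvingProg_spec I
  exact ⟨A, hA c hc⟩
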